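/- There are absolute constants $c,C>0$ such that the following holds. Let $q$ be an odd prime, let $n\geq 0$, and let $A\subseteq \mathbb{F}_q^n$ be a non-empty set of size $|A|=\alpha q^n$. Then the number of three-term arithmetic progressions in $A$, that is, of pairs $(x,d)\in\mathbb{F}_q^n\times\mathbb{F}_q^n$ with $x,\,x+d,\,x+2d\in A$ (the trivial ones with $d=0$ included), is at least \[c\,q^{2n-C\log(2/\alpha)^9}.\] In particular, for each fixed $q$, if $A\subseteq\mathbb{F}_q^n$ has size $|A|=\alpha q^n$ and contains no non-trivial three-term arithmetic progression (that is, $x,\,x+d,\,x+2d\in A$ implies $d=0$), then $\alpha\ll q^{-\Omega_q(n^{1/9})}$. More precisely, there are absolute constants $c',C'>0$ such that, for every odd prime $q$, every $n\ge 0$ and every such $A$, \[\alpha\leq C' q^{-c_q n^{1/9}},\qquad\text{where } c_q=\frac{c'}{\log q}.\] -/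

import Mathlib

/-- The three-term arithmetic progressions `x, x + d, x + 2d` in `A`, each recorded by its first
term `x` and its common difference `d`; the trivial progressions (`d = 0`) are included. -/
def threeAPs {G : Type*} [AddCommGroup G] [Fintype G] [DecidableEq G] (A : Finset G) :
    Finset (G × G) :=
  Finset.univ.filter fun p => p.1 ∈ A ∧ p.1 + p.2 ∈ A ∧ p.1 + 2 • p.2 ∈ A

/-! This is a Kelley–Meka density increment over subspaces. Put α = |A|/|G|, L = log(2/α), m =
|A|²/|G|, and let `f` be the indicator of A minus its mean. If A has at most half the expected
number of progressions, `selfconv f` is about -m/2 or lower on average over the doubled points of A.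
Its moments are dominated by those of `autocorr f` (`abs_sum_selfconv_pow_le`), so the p-th moment
of `autocorr (ind A)` is at least |A|(3m/2)^p (`le_sum_autocorr_pow_of_card_threeAPs_le`).

For p of order L, nearly all of this moment comes from points where the autocorrelation is at least
5m/4. Dependent random choice (`exists_sift`) turns this into a set B of density exp(-O(L²)), an
intersection of translates of A, with 95% of its differences at such points.

Croot–Sisask sampling gives a set T of almost periods for the density of differences of B in a given
set (`exists_almost_periods`). Smoothing by T - T and Chang's inequality replace T by a subspace W
(`norm_sum_submodule_sub_le`, `exists_submodule_annihilating_spectrum`). With k = O(L²), T has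
density exp(-O(k⁴)), so W has codimension O(k⁴) = O(L⁸). The autocorrelation is then large on most
of a translate of W, hence A has density at least 9α/8 on some translate of W
(`exists_density_increment`).

Density cannot exceed 1, so O(L) increments suffice. The total codimension is O(L⁹), and passing to
codimension d costs a factor q^(2d) in the count. -/

open Finset

/-! ### Indicator functions. -/

section Indicator

variable {α : Type*} [DecidableEq α]

/-- The real-valued indicator function of a finite set. -/
def ind (A : Finset α) (x : α) : ℝ := if x ∈ A then 1 else 0

lemma ind_nonneg (A : Finset α) (x : α) : 0 ≤ ind A x := by
  unfold ind; split_ifs <;> norm_num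

lemma sum_ind [Fintype α] (A : Finset α) : ∑ x, ind A x = A.card := by
  simp [ind]

end Indicator

/-! ### From few progressions to large moments of the autocorrelation. -/

section Moments

variable {G : Type*} [AddCommGroup G] [Fintype G]

/-- The autocorrelation `x ↦ ∑ y, f (x + y) * f y`. -/
def autocorr (f : G → ℝ) (x : G) : ℝ := ∑ y, f (x + y) * f y

/-- The self-convolution `x ↦ ∑ y, f y * f (x - y)`. -/
def selfconv (f : G → ℝ) (x : G) : ℝ := ∑ y, f y * f (x - y)

/-- Expanding the square over pairs (z, z') and translating every `y i` by z' leaves a sum that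
factorises over the coordinates and depends only on z - z'. In particular the moments of the
autocorrelation are nonnegative, odd ones included. -/
lemma sum_sq_sum_translates (f : G → ℝ) (j : ℕ) :
    ∑ y : Fin j → G, (∑ z, ∏ i, f (y i + z)) ^ 2 =
      Fintype.card G * ∑ x, autocorr f x ^ j := by
  have key : ∀ z' : G, ∑ z, ∑ y : Fin j → G, (∏ i, f (y i + z)) * (∏ i, f (y i + z')) =
      ∑ x, autocorr f x ^ j := by
    intro z'
    rw [← Equiv.sum_comp (Equiv.addRight z')]
    refine Finset.sum_congr rfl fun x _ => ?_
    rw [← Equiv.sum_comp (Equiv.subRight (fun _ : Fin j => z'))]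
    unfold autocorr
    rw [Fintype.sum_pow]
    refine Finset.sum_congr rfl fun y _ => ?_
    rw [← Finset.prod_mul_distrib]
    refine Finset.prod_congr rfl fun i _ => ?_
    simp only [Equiv.coe_addRight, Equiv.subRight_apply, Pi.sub_apply, sub_add_cancel]
    congr 2
    abel
  calc ∑ y : Fin j → G, (∑ z, ∏ i, f (y i + z)) ^ 2
      = ∑ y : Fin j → G, ∑ z', ∑ z, (∏ i, f (y i + z)) * (∏ i, f (y i + z')) := by
        refine Finset.sum_congr rfl fun y _ => ?_
        rw [sq, Finset.sum_mul_sum, Finset.sum_comm]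
    _ = ∑ z', ∑ z, ∑ y : Fin j → G, (∏ i, f (y i + z)) * (∏ i, f (y i + z')) := by
        rw [Finset.sum_comm]
        refine Finset.sum_congr rfl fun z' _ => ?_
        rw [Finset.sum_comm]
    _ = _ := by simp [key]

/-- The same expansion, but the second factor sees `-y`. This bilinear form is what Cauchy–Schwarz
compares with `sum_sq_sum_translates`. -/
lemma card_mul_sum_selfconv_pow (f : G → ℝ) (j : ℕ) :
    Fintype.card G * ∑ x, selfconv f x ^ j =
      ∑ y : Fin j → G, (∑ z, ∏ i, f (y i + z)) * (∑ z, ∏ i, f (-y i + z)) := by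
  have key : ∀ z : G, ∑ x, selfconv f x ^ j =
      ∑ x, ∑ y : Fin j → G, (∏ i, f (y i + z)) * ∏ i, f (-y i + x) := by
    intro z
    rw [← Equiv.sum_comp (Equiv.addRight z)]
    refine Finset.sum_congr rfl fun x _ => ?_
    unfold selfconv
    rw [Fintype.sum_pow, ← Equiv.sum_comp (Equiv.addRight (fun _ : Fin j => z))]
    refine Finset.sum_congr rfl fun y _ => ?_
    rw [← Finset.prod_mul_distrib]
    refine Finset.prod_congr rfl fun i _ => ?_
    simp only [Equiv.coe_addRight, Pi.add_apply]
    congr 2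
    abel
  calc (Fintype.card G : ℝ) * ∑ x, selfconv f x ^ j
      = ∑ z : G, ∑ x, selfconv f x ^ j := by simp
    _ = ∑ z : G, ∑ x, ∑ y : Fin j → G, (∏ i, f (y i + z)) * ∏ i, f (-y i + x) :=
        Finset.sum_congr rfl fun z _ => key z
    _ = _ := by
        simp_rw [Finset.sum_mul_sum]
        rw [Finset.sum_comm]
        conv_rhs => rw [Finset.sum_comm]
        rw [Finset.sum_comm]
        refine Finset.sum_congr rfl fun z _ => ?_
        rw [Finset.sum_comm]

/-- Decoupling: moments of the self-convolution are dominated by those of the autocorrelation. -/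
lemma abs_sum_selfconv_pow_le (f : G → ℝ) (j : ℕ) :
    |∑ x, selfconv f x ^ j| ≤ ∑ x, autocorr f x ^ j := by
  have hN : (0 : ℝ) < Fintype.card G := by exact_mod_cast Fintype.card_pos
  have h1 := sum_sq_sum_translates f j
  have h2 : ∑ y : Fin j → G, (∑ z, ∏ i, f (-y i + z)) ^ 2 =
      Fintype.card G * ∑ x, autocorr f x ^ j := by
    rw [← h1, ← Equiv.sum_comp (Equiv.neg (Fin j → G))]
    simp
  have h3 : |(Fintype.card G : ℝ) * ∑ x, selfconv f x ^ j| ≤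
      Fintype.card G * ∑ x, autocorr f x ^ j := by
    rw [card_mul_sum_selfconv_pow]
    refine (Finset.abs_sum_le_sum_abs _ _).trans ?_
    have : ∀ y : Fin j → G, |(∑ z, ∏ i, f (y i + z)) * (∑ z, ∏ i, f (-y i + z))| ≤
        ((∑ z, ∏ i, f (y i + z)) ^ 2 + (∑ z, ∏ i, f (-y i + z)) ^ 2) / 2 := by
      intro y
      rw [abs_le]
      constructor <;>
      nlinarith [sq_nonneg ((∑ z, ∏ i, f (y i + z)) + (∑ z, ∏ i, f (-y i + z))),
        sq_nonneg ((∑ z, ∏ i, f (y i + z)) - (∑ z, ∏ i, f (-y i + z)))]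
    refine (Finset.sum_le_sum fun y _ => this y).trans ?_
    rw [← Finset.sum_div, Finset.sum_add_distrib, h1, h2]
    linarith
  rw [abs_mul, abs_of_pos hN] at h3
  exact le_of_mul_le_mul_left h3 hN

/-- Binomial expansion reduces this to single moments. Since the powers of `m` are nonnegative, the
alternating signs are absorbed by the absolute value in `abs_sum_selfconv_pow_le`. -/
lemma sum_sub_selfconv_pow_le (f : G → ℝ) {m : ℝ} (hm : 0 ≤ m) (p : ℕ) :
    ∑ x, (m - selfconv f x) ^ p ≤ ∑ x, (m + autocorr f x) ^ p := by
  have e1 : ∑ x, (m - selfconv f x) ^ p =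
      ∑ j ∈ range (p + 1), ((-1) ^ j * ∑ x, selfconv f x ^ j) * (m ^ (p - j) * p.choose j) := by
    simp_rw [sub_eq_neg_add, add_pow, Finset.mul_sum, Finset.sum_mul]
    rw [Finset.sum_comm]
    refine Finset.sum_congr rfl fun j _ => Finset.sum_congr rfl fun x _ => ?_
    rw [neg_pow]; ring
  have e2 : ∑ x, (m + autocorr f x) ^ p =
      ∑ j ∈ range (p + 1), (∑ x, autocorr f x ^ j) * (m ^ (p - j) * p.choose j) := by
    simp_rw [add_comm m, add_pow, Finset.sum_mul]
    rw [Finset.sum_comm]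
    refine Finset.sum_congr rfl fun j _ => Finset.sum_congr rfl fun x _ => ?_
    ring
  rw [e1, e2]
  refine Finset.sum_le_sum fun j _ => mul_le_mul_of_nonneg_right ?_ (by positivity)
  refine le_trans (le_abs_self _) ?_
  rw [abs_mul, abs_pow, abs_neg, abs_one, one_pow, one_mul]
  exact abs_sum_selfconv_pow_le f j

variable [DecidableEq G]

lemma sum_ind_add_left (A : Finset G) (a : G) : ∑ x, ind A (a + x) = A.card := by
  rw [← sum_ind]; exact Equiv.sum_comp (Equiv.addLeft a) (ind A)

lemma sum_ind_sub_left (A : Finset G) (a : G) : ∑ x, ind A (a - x) = A.card := by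
  rw [← sum_ind]; exact Equiv.sum_comp (Equiv.subLeft a) (ind A)

lemma autocorr_ind_sub_const (A : Finset G) (x : G) :
    autocorr (fun y => ind A y - (A.card : ℝ) / Fintype.card G) x =
      autocorr (ind A) x - (A.card : ℝ) ^ 2 / Fintype.card G := by
  have hN : (Fintype.card G : ℝ) ≠ 0 := by exact_mod_cast Fintype.card_ne_zero
  unfold autocorr
  simp only [sub_mul, mul_sub, Finset.sum_sub_distrib, ← Finset.sum_mul, ← Finset.mul_sum,
    sum_ind, sum_ind_add_left, Finset.sum_const, Finset.card_univ, nsmul_eq_mul]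
  field_simp
  ring

lemma selfconv_ind_sub_const (A : Finset G) (x : G) :
    selfconv (fun y => ind A y - (A.card : ℝ) / Fintype.card G) x =
      selfconv (ind A) x - (A.card : ℝ) ^ 2 / Fintype.card G := by
  have hN : (Fintype.card G : ℝ) ≠ 0 := by exact_mod_cast Fintype.card_ne_zero
  unfold selfconv
  simp only [sub_mul, mul_sub, Finset.sum_sub_distrib, ← Finset.sum_mul, ← Finset.mul_sum,
    sum_ind, sum_ind_sub_left, Finset.sum_const, Finset.card_univ, nsmul_eq_mul]
  field_simp
  ring

/-- A progression is indexed by its middle term a: its end terms are the pairs in A with sum a + a.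
-/
lemma card_threeAPs_eq_sum_selfconv (A : Finset G) :
    ((threeAPs A).card : ℝ) = ∑ a ∈ A, selfconv (ind A) (a + a) := by
  have h1 : ((threeAPs A).card : ℝ) =
      ∑ x, ∑ d, ind A x * (ind A (x + d) * ind A (x + 2 • d)) := by
    rw [threeAPs, Finset.card_filter, ← Fintype.sum_prod_type']
    push_cast
    refine Finset.sum_congr rfl fun p _ => ?_
    unfold ind
    split_ifs <;> simp_all
  have h2 : ∑ a ∈ A, selfconv (ind A) (a + a) =
      ∑ x, ∑ a, ind A x * (ind A a * ind A (a + a - x)) := by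
    rw [Finset.sum_comm, ← Finset.sum_filter_add_sum_filter_not univ (· ∈ A)]
    have : ∑ a ∈ univ.filter (fun a => ¬ a ∈ A), ∑ x, ind A x * (ind A a * ind A (a + a - x)) = 0 := by
      refine Finset.sum_eq_zero fun a ha => Finset.sum_eq_zero fun x _ => ?_
      rw [show ind A a = 0 by simpa [ind] using ha]; ring
    rw [this, add_zero, Finset.filter_mem_eq_inter, Finset.univ_inter]
    refine Finset.sum_congr rfl fun a ha => Finset.sum_congr rfl fun x _ => ?_
    rw [show ind A a = 1 by simpa [ind] using ha]; ring
  rw [h1, h2]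
  refine Finset.sum_congr rfl fun x _ => ?_
  rw [← Equiv.sum_comp (Equiv.subRight x)]
  refine Finset.sum_congr rfl fun a _ => ?_
  simp only [Equiv.subRight_apply, add_sub_cancel]
  congr 3
  rw [two_nsmul]; abel

/-- A set with few three-term progressions has large autocorrelation moments. -/
lemma le_sum_autocorr_pow_of_card_threeAPs_le (h2 : Function.Injective fun x : G => x + x)
    {A : Finset G} (hA : A.Nonempty)
    (hT : ((threeAPs A).card : ℝ) ≤ (A.card : ℝ) ^ 3 / Fintype.card G / 2) {p : ℕ} (hp : Even p) :
    A.card * (3 / 2 * ((A.card : ℝ) ^ 2 / Fintype.card G)) ^ p ≤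
      ∑ x, autocorr (ind A) x ^ p := by
  have hN : (0 : ℝ) < Fintype.card G := by exact_mod_cast Fintype.card_pos
  have hA0 : (0 : ℝ) < A.card := by exact_mod_cast hA.card_pos
  set m : ℝ := (A.card : ℝ) ^ 2 / Fintype.card G with hm
  have hm0 : 0 ≤ m := by positivity
  set f : G → ℝ := fun y => ind A y - (A.card : ℝ) / Fintype.card G with hf
  -- Balancing subtracts exactly m from the autocorrelation, so adding m back recovers that of A
  -- itself.
  have e1 : ∑ x, autocorr (ind A) x ^ p = ∑ x, (m + autocorr f x) ^ p := by
    refine Finset.sum_congr rfl fun x _ => ?_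
    rw [hf, autocorr_ind_sub_const, ← hm]; ring
  rw [e1]
  refine le_trans ?_ (sum_sub_selfconv_pow_le f hm0 p)
  -- Keep only the doubled points of A, which are distinct; the discarded terms are nonnegative
  -- because p is even.
  have e2 : ∑ a ∈ A, (m - selfconv f (a + a)) ^ p ≤ ∑ x, (m - selfconv f x) ^ p := by
    rw [← Finset.sum_image (f := fun x => (m - selfconv f x) ^ p) (g := fun a => a + a)
      (s := A) (h2.injOn)]
    exact Finset.sum_le_sum_of_subset_of_nonneg (Finset.subset_univ _)
      fun x _ _ => hp.pow_nonneg _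
  refine le_trans ?_ e2
  have jen := Real.pow_arith_mean_le_arith_mean_pow_of_even A (fun _ => (1 : ℝ) / A.card)
    (fun a => m - selfconv f (a + a)) (fun _ _ => by positivity) (by simp [hA0.ne']) hp
  simp only [← Finset.mul_sum] at jen
  -- The mean over A is 2m minus the number of progressions per point of A, and the latter is at
  -- most m/2.
  have e3 : 3 / 2 * m ≤ 1 / (A.card : ℝ) * ∑ a ∈ A, (m - selfconv f (a + a)) := by
    have : ∑ a ∈ A, (m - selfconv f (a + a)) = A.card * (2 * m) - (threeAPs A).card := by
      rw [card_threeAPs_eq_sum_selfconv]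
      simp only [hf, selfconv_ind_sub_const, ← hm, Finset.sum_sub_distrib, Finset.sum_const,
        nsmul_eq_mul]
      ring
    rw [this, one_div, inv_mul_eq_div, le_div_iff₀ hA0]
    have : (A.card : ℝ) ^ 3 / Fintype.card G = A.card * m := by rw [hm]; ring
    rw [this] at hT
    linarith
  have e4 := (pow_le_pow_left₀ (by positivity) e3 p).trans jen
  rw [one_div, inv_mul_eq_div, le_div_iff₀ hA0] at e4
  linarith

end Moments

/-! ### Dependent random choice. -/

section Sifting

variable {G : Type*} [AddCommGroup G] [Fintype G] [DecidableEq G]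

/-- For fixed u and v, each coordinate of s independently has `autocorr (ind A) (u - v)` admissible
values, whence the p-th power. Weight 1 gives the mean square size of the intersection; an indicator
weight counts its bad differences. -/
lemma sum_sum_filter_translates (A : Finset G) (w : G → ℝ) (p : ℕ) :
    ∑ s : Fin p → G, ∑ u ∈ univ.filter (fun u => ∀ i, u - s i ∈ A),
      ∑ v ∈ univ.filter (fun v => ∀ i, v - s i ∈ A), w (u - v) =
      Fintype.card G * ∑ x, w x * autocorr (ind A) x ^ p := by
  have hind : ∀ (s : Fin p → G) (u : G),
      (if ∀ i, u - s i ∈ A then (1 : ℝ) else 0) = ∏ i, ind A (u - s i) := by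
    intro s u
    unfold ind
    rw [Finset.prod_ite_zero]
    simp
  have h1 : ∀ s : Fin p → G, ∑ u ∈ univ.filter (fun u => ∀ i, u - s i ∈ A),
      ∑ v ∈ univ.filter (fun v => ∀ i, v - s i ∈ A), w (u - v) =
      ∑ u, ∑ v, w (u - v) * ∏ i, (ind A (u - s i) * ind A (v - s i)) := by
    intro s
    rw [Finset.sum_filter]
    refine Finset.sum_congr rfl fun u _ => ?_
    rw [Finset.sum_filter]
    simp_rw [Finset.prod_mul_distrib, ← hind]
    split_ifs with h
    · refine Finset.sum_congr rfl fun v _ => ?_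
      split_ifs <;> simp
    · simp
  have h2 : ∀ u v : G, ∑ s : Fin p → G, ∏ i, (ind A (u - s i) * ind A (v - s i)) =
      autocorr (ind A) (u - v) ^ p := by
    intro u v
    unfold autocorr
    rw [Fintype.sum_pow, ← Equiv.sum_comp (Equiv.subLeft (fun _ : Fin p => v))]
    refine Finset.sum_congr rfl fun s _ => Finset.prod_congr rfl fun i _ => ?_
    simp only [Equiv.subLeft_apply, Pi.sub_apply, sub_sub_cancel]
    congr 2
    abel
  simp_rw [h1]
  rw [Finset.sum_comm]
  calc ∑ u, ∑ s : Fin p → G, ∑ v, w (u - v) * ∏ i, (ind A (u - s i) * ind A (v - s i))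
      = ∑ u, ∑ v, w (u - v) * autocorr (ind A) (u - v) ^ p := by
        refine Finset.sum_congr rfl fun u _ => ?_
        rw [Finset.sum_comm]
        refine Finset.sum_congr rfl fun v _ => ?_
        rw [← Finset.mul_sum, h2]
    _ = ∑ _u : G, ∑ x, w x * autocorr (ind A) x ^ p := by
        refine Finset.sum_congr rfl fun u _ => ?_
        exact Equiv.sum_comp (Equiv.subLeft u) (fun x => w x * autocorr (ind A) x ^ p)
    _ = _ := by simp

/-- Sifting: if the `p`-th moment of the autocorrelation of `A` is concentrated on `{r ≥ t}`, some
intersection of translates of `A` has most of its differences there. -/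
lemma exists_sift (A : Finset G) (p : ℕ) (t : ℝ)
    (ht : 40 * ∑ x, (if autocorr (ind A) x < t then (1 : ℝ) else 0) * autocorr (ind A) x ^ p ≤
      ∑ x, autocorr (ind A) x ^ p) :
    ∃ B : Finset G,
      (∑ x, autocorr (ind A) x ^ p) * Fintype.card G ≤
        2 * ((B.card : ℝ) ^ 2 * (Fintype.card G : ℝ) ^ p) ∧
      20 * ∑ u ∈ B, ∑ v ∈ B, (if autocorr (ind A) (u - v) < t then (1 : ℝ) else 0) ≤
        (B.card : ℝ) ^ 2 := by
  set w : G → ℝ := fun x => if autocorr (ind A) x < t then (1 : ℝ) else 0 with hw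
  set M := ∑ x, autocorr (ind A) x ^ p with hM
  have hN : (0 : ℝ) < Fintype.card G := by exact_mod_cast Fintype.card_pos
  have hr : ∀ x, 0 ≤ autocorr (ind A) x := fun x =>
    Finset.sum_nonneg fun y _ => mul_nonneg (ind_nonneg _ _) (ind_nonneg _ _)
  have hM0 : 0 ≤ M := Finset.sum_nonneg fun x _ => pow_nonneg (hr x) _
  have hX := sum_sum_filter_translates A (fun _ => 1) p
  have hY := sum_sum_filter_translates A w p
  simp only [Finset.sum_const, nsmul_eq_mul, mul_one, one_mul] at hX
  -- One averaged inequality yields both conclusions: half of the total of |B|² pays for 20 times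
  -- the bad pairs, the other half for the lower bound on |B|.
  obtain ⟨s, -, hs⟩ := Finset.exists_le_of_sum_le (s := (univ : Finset (Fin p → G)))
    (f := fun s : Fin p → G => 20 * (∑ u ∈ univ.filter (fun u : G => ∀ i : Fin p, u - s i ∈ A),
      ∑ v ∈ univ.filter (fun v : G => ∀ i : Fin p, v - s i ∈ A), w (u - v)) +
        M * Fintype.card G / 2 / (Fintype.card G : ℝ) ^ p)
    (g := fun s : Fin p → G => ((univ.filter (fun u : G => ∀ i : Fin p, u - s i ∈ A)).card : ℝ) *
      (univ.filter (fun u : G => ∀ i : Fin p, u - s i ∈ A)).card) univ_nonempty (by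
      rw [Finset.sum_add_distrib, ← Finset.mul_sum, hY, hX]
      simp only [Finset.sum_const, Finset.card_univ, Fintype.card_pi, Finset.prod_const,
        Fintype.card_fin, nsmul_eq_mul]
      push_cast
      rw [mul_div_cancel₀ _ (by positivity)]
      nlinarith)
  refine ⟨univ.filter (fun u : G => ∀ i : Fin p, u - s i ∈ A), ?_, ?_⟩
  · have : M * Fintype.card G / 2 / (Fintype.card G : ℝ) ^ p ≤
        ((univ.filter (fun u : G => ∀ i : Fin p, u - s i ∈ A)).card : ℝ) ^ 2 := by
      rw [sq]
      refine le_trans ?_ hs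
      refine le_add_of_nonneg_left (mul_nonneg (by norm_num)
        (Finset.sum_nonneg fun u _ => Finset.sum_nonneg fun v _ => ?_))
      simp only [hw]; split_ifs <;> norm_num
    rw [div_le_iff₀ (by positivity)] at this
    linarith
  · rw [sq]
    refine le_trans ?_ hs
    exact le_add_of_nonneg_right (by positivity)

end Sifting

/-! ### Croot–Sisask almost periodicity by random sampling. -/

section Sampling

/-- By convexity, the exponential lies below its chord between -s and s. -/
lemma exp_mul_le_cosh_add_mul_sinh (s : ℝ) {y : ℝ} (hy : |y| ≤ 1) :
    Real.exp (s * y) ≤ Real.cosh s + y * Real.sinh s := by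
  obtain ⟨h1, h2⟩ := abs_le.1 hy
  have h := convexOn_exp.2 (Set.mem_univ s) (Set.mem_univ (-s))
    (show 0 ≤ (1 + y) / 2 by linarith) (show 0 ≤ (1 - y) / 2 by linarith) (by ring)
  simp only [smul_eq_mul] at h
  rw [Real.cosh_eq, Real.sinh_eq]
  have e : (1 + y) / 2 * s + (1 - y) / 2 * -s = s * y := by ring
  rw [e] at h
  linarith

/-- Hoeffding's lemma for finite sums. -/
lemma sum_exp_mul_le {ι : Type*} (S : Finset ι) (s : ℝ) {Y : ι → ℝ} (hY : ∀ i ∈ S, |Y i| ≤ 1)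
    (h0 : ∑ i ∈ S, Y i = 0) : ∑ i ∈ S, Real.exp (s * Y i) ≤ S.card * Real.exp (s ^ 2 / 2) := by
  calc ∑ i ∈ S, Real.exp (s * Y i) ≤ ∑ i ∈ S, (Real.cosh s + Y i * Real.sinh s) :=
        Finset.sum_le_sum fun i hi => exp_mul_le_cosh_add_mul_sinh s (hY i hi)
    _ = S.card * Real.cosh s := by
        rw [Finset.sum_add_distrib, ← Finset.sum_mul, h0]; simp
    _ ≤ _ := mul_le_mul_of_nonneg_left (Real.cosh_le_exp_half_sq s) (by positivity)

/-- Hoeffding's inequality for the average of `n` independent samples from `S`. -/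
lemma sum_exp_average_le {ι : Type*} (S : Finset ι) {n : ℕ} (hn : n ≠ 0) (s : ℝ)
    {Y : ι → ℝ} (hY : ∀ i ∈ S, |Y i| ≤ 1) (h0 : ∑ i ∈ S, Y i = 0) :
    ∑ a ∈ Fintype.piFinset fun _ : Fin n => S, Real.exp (s * ((∑ i, Y (a i)) / n)) ≤
      (S.card : ℝ) ^ n * Real.exp (s ^ 2 / (2 * n)) := by
  have hn' : (n : ℝ) ≠ 0 := by exact_mod_cast hn
  calc ∑ a ∈ Fintype.piFinset fun _ : Fin n => S, Real.exp (s * ((∑ i, Y (a i)) / n))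
      = ∑ a ∈ Fintype.piFinset fun _ : Fin n => S, ∏ i, Real.exp (s / n * Y (a i)) := by
        refine Finset.sum_congr rfl fun a _ => ?_
        rw [← Real.exp_sum, ← Finset.mul_sum]
        congr 1; ring
    _ = (∑ j ∈ S, Real.exp (s / n * Y j)) ^ n := by
        rw [Finset.sum_prod_piFinset S fun _ j => Real.exp (s / n * Y j)]
        simp
    _ ≤ (S.card * Real.exp ((s / n) ^ 2 / 2)) ^ n :=
        pow_le_pow_left₀ (Finset.sum_nonneg fun _ _ => (Real.exp_pos _).le)
          (sum_exp_mul_le S _ hY h0) n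
    _ = _ := by
        rw [mul_pow, ← Real.exp_nat_mul]
        congr 2
        field_simp

variable {G : Type*} [AddCommGroup G] [Fintype G] [DecidableEq G]

/-- Pigeonholing over diagonal translates. -/
lemma exists_card_diagonal_fiber_ge {n : ℕ} (L : Finset (Fin n → G)) :
    ∃ c : Fin n → G, L.card * Fintype.card G ≤
      (univ.filter fun t : G => (fun i => c i + t) ∈ L).card * Fintype.card G ^ n := by
  obtain ⟨c, -, hc⟩ := Finset.exists_le_of_sum_le (s := (univ : Finset (Fin n → G)))
    (f := fun _ => L.card * Fintype.card G)
    (g := fun c => (univ.filter fun t : G => (fun i => c i + t) ∈ L).card * Fintype.card G ^ n)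
    univ_nonempty (by
      have h1 : ∀ t : G, ∑ c : Fin n → G, (if (fun i => c i + t) ∈ L then 1 else 0) = L.card := by
        intro t
        refine (Equiv.sum_comp (Equiv.addRight (fun _ : Fin n => t))
          (fun c => if c ∈ L then 1 else 0)).trans ?_
        simp
      have h2 : ∑ c : Fin n → G, (univ.filter fun t : G => (fun i => c i + t) ∈ L).card =
          Fintype.card G * L.card := by
        simp only [Finset.card_filter]
        rw [Finset.sum_comm]
        simp only [h1, Finset.sum_const, Finset.card_univ, smul_eq_mul]
      conv_rhs => rw [← Finset.sum_mul, h2]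
      simp only [Finset.sum_const, Finset.card_univ, Fintype.card_pi, Finset.prod_const,
        Fintype.card_fin, smul_eq_mul]
      apply le_of_eq; ring)
  exact ⟨c, hc⟩

/-- Sampling: for many shifts `t`, one fixed function shifted by `t` approximates
`x ↦ ∑ b ∈ B, g (x - b) / |B|` in exponential mean. -/
lemma exists_sample {B : Finset G} (hB : B.Nonempty) {g : G → ℝ} (hg0 : ∀ x, 0 ≤ g x)
    (hg1 : ∀ x, g x ≤ 1) {n : ℕ} (hn : n ≠ 0) (s : ℝ) :
    ∃ (φ : G → ℝ) (T : Finset G),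
      (B.card : ℝ) ^ n * Fintype.card G ≤ 2 * (T.card * (Fintype.card G : ℝ) ^ n) ∧
      ∀ t ∈ T, ∑ x, Real.exp (s * |φ (x - t) - (∑ b ∈ B, g (x - b)) / B.card|) ≤
        4 * (Fintype.card G * Real.exp (s ^ 2 / (2 * n))) := by
  have hn' : (n : ℝ) ≠ 0 := by exact_mod_cast hn
  have hB0 : (0 : ℝ) < B.card := by exact_mod_cast hB.card_pos
  have hN : (0 : ℝ) < Fintype.card G := by exact_mod_cast Fintype.card_pos
  set h : G → ℝ := fun x => (∑ b ∈ B, g (x - b)) / B.card with hh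
  have hh0 : ∀ x, 0 ≤ h x := fun x => div_nonneg (Finset.sum_nonneg fun _ _ => hg0 _) hB0.le
  have hh1 : ∀ x, h x ≤ 1 := fun x => by
    rw [hh, div_le_one hB0]
    exact (Finset.sum_le_sum fun b _ => hg1 (x - b)).trans (by simp)
  set avg : (Fin n → G) → G → ℝ := fun a x => (∑ i, g (x - a i)) / n with havg
  set E : ℝ := Real.exp (s ^ 2 / (2 * n)) with hE
  have hE0 : 0 < E := Real.exp_pos _
  have hoeff : ∀ (σ : ℝ) (x : G), σ ^ 2 = s ^ 2 →
      ∑ a ∈ Fintype.piFinset fun _ : Fin n => B, Real.exp (σ * (avg a x - h x)) ≤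
        (B.card : ℝ) ^ n * E := by
    intro σ x hσ
    have := sum_exp_average_le B hn σ (Y := fun b => g (x - b) - h x)
      (fun b _ => abs_le.2 ⟨by linarith [hg0 (x - b), hh1 x], by linarith [hg1 (x - b), hh0 x]⟩)
      (by simp [hh, mul_div_cancel₀ _ hB0.ne'])
    rw [hσ] at this
    refine le_trans (le_of_eq ?_) this
    refine Finset.sum_congr rfl fun a _ => ?_
    congr 2
    simp only [havg, Finset.sum_sub_distrib, Finset.sum_const, Finset.card_univ,
      Fintype.card_fin, nsmul_eq_mul]
    field_simp
  set D : (Fin n → G) → ℝ := fun a => ∑ x, Real.exp (s * |avg a x - h x|) with hD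
  have hD0 : ∀ a, 0 ≤ D a := fun a => Finset.sum_nonneg fun _ _ => (Real.exp_pos _).le
  have hDsum : ∑ a ∈ Fintype.piFinset fun _ : Fin n => B, D a ≤
      2 * (Fintype.card G * ((B.card : ℝ) ^ n * E)) := by
    rw [hD, Finset.sum_comm]
    calc ∑ x, ∑ a ∈ Fintype.piFinset fun _ : Fin n => B, Real.exp (s * |avg a x - h x|)
        ≤ ∑ x : G, ((B.card : ℝ) ^ n * E + (B.card : ℝ) ^ n * E) := by
          refine Finset.sum_le_sum fun x _ => ?_
          refine le_trans ?_ (add_le_add (hoeff s x rfl) (hoeff (-s) x (by ring)))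
          rw [← Finset.sum_add_distrib]
          refine Finset.sum_le_sum fun a _ => ?_
          rcases abs_choice (avg a x - h x) with e | e <;> rw [e]
          · linarith [Real.exp_pos (-s * (avg a x - h x))]
          · rw [mul_neg, ← neg_mul]
            linarith [Real.exp_pos (s * (avg a x - h x))]
      _ = _ := by simp; ring
  -- The mean of `D` over samples is at most half this threshold, so by Markov at least half of the
  -- samples are good.
  set L := (Fintype.piFinset fun _ : Fin n => B).filter
    fun a => D a ≤ 4 * (Fintype.card G * E) with hL
  have hLcard : (B.card : ℝ) ^ n ≤ 2 * L.card := by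
    have hsplit : (L.card : ℝ) + ((Fintype.piFinset fun _ : Fin n => B).filter
        fun a => ¬ D a ≤ 4 * (Fintype.card G * E)).card = (B.card : ℝ) ^ n := by
      rw [hL]
      have := Finset.card_filter_add_card_filter_not (s := Fintype.piFinset fun _ : Fin n => B)
        (fun a => D a ≤ 4 * (Fintype.card G * E))
      rw [Fintype.card_piFinset_const] at this
      exact_mod_cast this
    have hbad : (((Fintype.piFinset fun _ : Fin n => B).filter
        fun a => ¬ D a ≤ 4 * (Fintype.card G * E)).card : ℝ) * (4 * (Fintype.card G * E)) ≤
        2 * (Fintype.card G * ((B.card : ℝ) ^ n * E)) := by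
      refine le_trans ?_ hDsum
      refine le_trans ?_ (Finset.sum_le_sum_of_subset_of_nonneg (Finset.filter_subset
        (fun a => ¬ D a ≤ 4 * (Fintype.card G * E)) _) fun a _ _ => hD0 a)
      rw [← nsmul_eq_mul]
      exact Finset.card_nsmul_le_sum _ _ _ fun a ha =>
        (not_le.1 (Finset.mem_filter.1 ha).2).le
    have hpos : 0 < Fintype.card G * E := by positivity
    have : (((Fintype.piFinset fun _ : Fin n => B).filter
        fun a => ¬ D a ≤ 4 * (Fintype.card G * E)).card : ℝ) * 4 ≤ 2 * (B.card : ℝ) ^ n := by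
      refine le_of_mul_le_mul_right ?_ hpos
      linarith
    linarith
  -- Many good samples are diagonal translates of one tuple `c`. Translating a sample translates its
  -- average, so the single function `avg c` serves for every shift.
  obtain ⟨c, hc⟩ := exists_card_diagonal_fiber_ge L
  refine ⟨avg c, univ.filter fun t : G => (fun i => c i + t) ∈ L, ?_, ?_⟩
  · have : (L.card : ℝ) * Fintype.card G ≤
      (univ.filter fun t : G => (fun i => c i + t) ∈ L).card * (Fintype.card G : ℝ) ^ n := by
      exact_mod_cast hc
    have := mul_le_mul_of_nonneg_right hLcard hN.le
    linarith
  · intro t ht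
    have := (Finset.mem_filter.1 (Finset.mem_filter.1 ht).2).2
    refine le_trans (le_of_eq ?_) this
    refine Finset.sum_congr rfl fun x _ => ?_
    simp only [havg, hh]
    congr 5
    refine Finset.sum_congr rfl fun i _ => ?_
    congr 1; abel

/-- Almost periodicity of `y ↦ ∑ u ∈ B, ∑ v ∈ B, g (u - v + y) / |B|²` in the uniform norm. -/
lemma exists_almost_periods {B : Finset G} (hB : B.Nonempty) {g : G → ℝ} (hg0 : ∀ x, 0 ≤ g x)
    (hg1 : ∀ x, g x ≤ 1) {k : ℕ} (hk : k ≠ 0)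
    (hkB : 1000 * (Fintype.card G : ℝ) ≤ Real.exp k * B.card) :
    ∃ T : Finset G,
      (B.card : ℝ) ^ (204800 * k ^ 3) * Fintype.card G ≤
        2 * (T.card * (Fintype.card G : ℝ) ^ (204800 * k ^ 3)) ∧
      ∀ t ∈ T, ∀ t' ∈ T, ∀ y,
        |(∑ u ∈ B, ∑ v ∈ B, g (u - v + (y + t))) / (B.card : ℝ) ^ 2 -
          (∑ u ∈ B, ∑ v ∈ B, g (u - v + (y + t'))) / (B.card : ℝ) ^ 2| ≤ 1 / (160 * k) := by
  have hk' : (0 : ℝ) < k := by exact_mod_cast Nat.pos_of_ne_zero hk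
  have hB0 : (0 : ℝ) < B.card := by exact_mod_cast hB.card_pos
  -- With n = 204800 k³ this makes s²/(2n) = k, while 2k/s = 1/(320k) is the desired error.
  set s : ℝ := 640 * k ^ 2 with hs
  obtain ⟨φ, T, hT, hφ⟩ := exists_sample hB hg0 hg1 (n := 204800 * k ^ 3) (by positivity) s
  refine ⟨T, hT, ?_⟩
  have hsn : s ^ 2 / (2 * ((204800 * k ^ 3 : ℕ) : ℝ)) = k := by
    rw [hs]; push_cast; field_simp; norm_num
  rw [hsn] at hφ
  set h : G → ℝ := fun x => (∑ b ∈ B, g (x - b)) / B.card with hh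
  have hF : ∀ y, (∑ u ∈ B, ∑ v ∈ B, g (u - v + y)) / (B.card : ℝ) ^ 2 =
      (∑ u ∈ B, h (u + y)) / B.card := by
    intro y
    simp only [hh, ← Finset.sum_div]
    rw [div_div, sq]
    congr 1
    refine Finset.sum_congr rfl fun u _ => Finset.sum_congr rfl fun v _ => ?_
    congr 1; abel
  have key : ∀ t ∈ T, ∀ y, |(∑ u ∈ B, h (u + (y + t))) / B.card -
      (∑ u ∈ B, φ (u + y)) / B.card| ≤ 1 / (320 * k) := by
    intro t ht y
    have h1 := hφ t ht
    have h2 : ∑ u ∈ B, Real.exp (s * |φ (u + y) - h (u + (y + t))|) ≤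
        4 * (Fintype.card G * Real.exp k) := by
      refine le_trans ?_ h1
      rw [← Equiv.sum_comp (Equiv.addRight (y + t))]
      refine le_trans (le_of_eq ?_) (Finset.sum_le_sum_of_subset_of_nonneg
        (Finset.subset_univ B) fun _ _ _ => (Real.exp_pos _).le)
      refine Finset.sum_congr rfl fun u _ => ?_
      simp only [Equiv.coe_addRight]
      congr 5
      abel
    -- The tangent line to exp at 2k plays the role of Jensen. Restricting the sum from G to B costs
    -- |G|/|B|, which the extra factor exp k covers, so the bound is uniform in y.
    have h3 : ∑ u ∈ B, (s * |φ (u + y) - h (u + (y + t))| - 2 * k + 1) ≤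
        Real.exp (-(2 * k)) * (4 * (Fintype.card G * Real.exp k)) := by
      refine le_trans ?_ (mul_le_mul_of_nonneg_left h2 (Real.exp_pos _).le)
      rw [Finset.mul_sum]
      refine Finset.sum_le_sum fun u _ => ?_
      rw [← Real.exp_add]
      refine le_trans (le_of_eq ?_) (Real.add_one_le_exp _)
      ring
    have h4 : Real.exp (-(2 * k)) * (4 * (Fintype.card G * Real.exp k)) ≤ B.card := by
      have e1 : Real.exp (-(2 * k : ℝ)) * Real.exp k * Real.exp k = 1 := by
        rw [← Real.exp_add, ← Real.exp_add, ← Real.exp_zero]; congr 1; ring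
      have e2 := mul_le_mul_of_nonneg_left hkB
        (mul_pos (Real.exp_pos (-(2 * k : ℝ))) (Real.exp_pos k)).le
      have e3 : Real.exp (-(2 * k : ℝ)) * Real.exp k * (Real.exp k * B.card) = B.card := by
        rw [← mul_assoc, e1, one_mul]
      rw [e3] at e2
      have : 0 ≤ Real.exp (-(2 * k : ℝ)) * Real.exp k * (Fintype.card G : ℝ) := by positivity
      nlinarith
    have h5 : s * ∑ u ∈ B, |φ (u + y) - h (u + (y + t))| ≤ 2 * k * B.card := by
      simp only [Finset.sum_add_distrib, Finset.sum_sub_distrib, ← Finset.mul_sum,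
        Finset.sum_const, nsmul_eq_mul] at h3
      linarith
    rw [← sub_div, ← Finset.sum_sub_distrib, abs_div, abs_of_pos hB0, div_le_iff₀ hB0]
    have h6 : |∑ u ∈ B, (h (u + (y + t)) - φ (u + y))| ≤
        ∑ u ∈ B, |φ (u + y) - h (u + (y + t))| := by
      refine (Finset.abs_sum_le_sum_abs _ _).trans (le_of_eq ?_)
      exact Finset.sum_congr rfl fun u _ => abs_sub_comm _ _
    refine h6.trans ?_
    have hs0 : 0 < s := by positivity
    refine le_of_mul_le_mul_left (h5.trans (le_of_eq ?_)) hs0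
    rw [hs]; field_simp; norm_num
  intro t ht t' ht' y
  rw [hF, hF]
  have h1 := abs_le.1 (key t ht y)
  have h2 := abs_le.1 (key t' ht' y)
  have e : (1 : ℝ) / (160 * k) = 1 / (320 * k) + 1 / (320 * k) := by field_simp; norm_num
  rw [e, abs_le]
  constructor <;> linarith [h1.1, h1.2, h2.1, h2.2]

end Sampling

/-! ### Fourier analysis with linear functionals, and smoothing by T - T. -/

section Fourier

variable {q : ℕ} [Fact q.Prime] {G : Type*} [AddCommGroup G] [Module (ZMod q) G]

/-- The additive character of `G` attached to a linear functional. -/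
noncomputable def dualChar (ℓ : Module.Dual (ZMod q) G) : AddChar G ℂ :=
  (ZMod.stdAddChar (N := q)).compAddMonoidHom ℓ.toAddMonoidHom

lemma dualChar_apply (ℓ : Module.Dual (ZMod q) G) (x : G) :
    dualChar ℓ x = ZMod.stdAddChar (ℓ x) := rfl

variable [Fintype G]

lemma norm_dualChar (ℓ : Module.Dual (ZMod q) G) (x : G) : ‖dualChar ℓ x‖ = 1 :=
  AddChar.norm_apply _ _

lemma card_dual [Fintype (Module.Dual (ZMod q) G)] :
    Fintype.card (Module.Dual (ZMod q) G) = Fintype.card G := by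
  rw [Module.card_eq_pow_finrank (K := ZMod q), Module.card_eq_pow_finrank (K := ZMod q) (V := G),
    Subspace.dual_finrank_eq]

/-- Evaluation at x is a character of the dual space, nontrivial for x ≠ 0 because functionals
separate points. -/
lemma sum_dualChar [Fintype (Module.Dual (ZMod q) G)] [DecidableEq G] (x : G) :
    ∑ ℓ : Module.Dual (ZMod q) G, dualChar ℓ x = if x = 0 then (Fintype.card G : ℂ) else 0 := by
  split_ifs with hx
  · subst hx
    simp [card_dual]
  · set ψ : AddChar (Module.Dual (ZMod q) G) ℂ :=
      (ZMod.stdAddChar (N := q)).compAddMonoidHom (Module.Dual.eval (ZMod q) G x).toAddMonoidHom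
      with hψ
    have h1 : ψ ≠ 1 := by
      intro h
      refine hx ((Module.forall_dual_apply_eq_zero_iff (ZMod q) x).1 fun ℓ => ?_)
      have h2 : ψ ℓ = 1 := by rw [h]; rfl
      have h3 : ZMod.stdAddChar (ℓ x) = (ZMod.stdAddChar (0 : ZMod q) : ℂ) := by
        rw [AddChar.map_zero_eq_one]; exact h2
      exact ZMod.injective_stdAddChar h3
    exact AddChar.sum_eq_zero_of_ne_one h1

lemma eq_sum_dualChar [Fintype (Module.Dual (ZMod q) G)] (g : G → ℂ) (z : G) :
    g z = ∑ ℓ : Module.Dual (ZMod q) G,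
      (∑ w, g w * dualChar ℓ (-w)) / Fintype.card G * dualChar ℓ z := by
  classical
  have hN : (Fintype.card G : ℂ) ≠ 0 := by exact_mod_cast Fintype.card_ne_zero
  have h : ∀ ℓ : Module.Dual (ZMod q) G,
      (∑ w, g w * dualChar ℓ (-w)) / Fintype.card G * dualChar ℓ z =
        ∑ w, g w / Fintype.card G * dualChar ℓ (z - w) := by
    intro ℓ
    rw [Finset.sum_div, Finset.sum_mul]
    refine Finset.sum_congr rfl fun w _ => ?_
    rw [sub_eq_add_neg, AddChar.map_add_eq_mul]
    ring
  simp_rw [h]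
  rw [Finset.sum_comm]
  simp_rw [← Finset.mul_sum, sum_dualChar, sub_eq_zero]
  simp [div_mul_cancel₀ _ hN]

lemma sum_sum_dualChar_sub (T : Finset G) (ℓ : Module.Dual (ZMod q) G) :
    ∑ t ∈ T, ∑ t' ∈ T, dualChar ℓ (t - t') = ((‖∑ t ∈ T, dualChar ℓ t‖ ^ 2 : ℝ) : ℂ) := by
  rw [Complex.ofReal_pow, ← Complex.mul_conj', map_sum, Finset.sum_mul_sum]
  refine Finset.sum_congr rfl fun t _ => Finset.sum_congr rfl fun t' _ => ?_
  rw [sub_eq_add_neg, AddChar.map_add_eq_mul, AddChar.map_neg_eq_conj]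

/-- Parseval's identity for the indicator function of a set. -/
lemma sum_norm_sq_sum_dualChar [Fintype (Module.Dual (ZMod q) G)] (B : Finset G) :
    ∑ ℓ : Module.Dual (ZMod q) G, ‖∑ u ∈ B, dualChar ℓ u‖ ^ 2 =
      Fintype.card G * B.card := by
  classical
  have : ((∑ ℓ : Module.Dual (ZMod q) G, ‖∑ u ∈ B, dualChar ℓ u‖ ^ 2 : ℝ) : ℂ) =
      ((Fintype.card G * B.card : ℝ) : ℂ) := by
    rw [Complex.ofReal_sum]
    simp_rw [← sum_sum_dualChar_sub]
    rw [Finset.sum_comm]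
    have h : ∀ u ∈ B, ∑ ℓ : Module.Dual (ZMod q) G, ∑ v ∈ B, dualChar ℓ (u - v) =
        (Fintype.card G : ℂ) := by
      intro u hu
      rw [Finset.sum_comm]
      simp_rw [sum_dualChar, sub_eq_zero]
      simp [hu]
    rw [Finset.sum_congr rfl h]
    simp [mul_comm]
  exact_mod_cast this

lemma norm_sum_sum_div_card_sq_le {α : Type*} {T : Finset α} (hT : T.Nonempty) {a : α → α → ℂ} {C : ℝ}
    (h : ∀ t ∈ T, ∀ t' ∈ T, ‖a t t'‖ ≤ C) :
    ‖(∑ t ∈ T, ∑ t' ∈ T, a t t') / (T.card : ℂ) ^ 2‖ ≤ C := by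
  have hT0 : (0 : ℝ) < T.card := by exact_mod_cast hT.card_pos
  rw [norm_div, norm_pow, Complex.norm_natCast, div_le_iff₀ (by positivity)]
  refine (norm_sum_le_of_le T fun t ht => norm_sum_le_of_le T fun t' ht' =>
    h t ht t' ht').trans (le_of_eq ?_)
  simp only [Finset.sum_const, nsmul_eq_mul]
  ring

/-- Averaging `k` times over differences of almost periods moves a function by at most `k * η`. -/
lemma norm_iterated_average_sub_le {H : Type*} [AddCommGroup H] {T : Finset H}
    (hT : T.Nonempty) {F : ℕ → H → ℂ} {η : ℝ}
    (hstep : ∀ j y, F (j + 1) y =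
      (∑ t ∈ T, ∑ t' ∈ T, F j (y + (t - t'))) / (T.card : ℂ) ^ 2)
    (hη : ∀ t ∈ T, ∀ t' ∈ T, ∀ y, ‖F 0 (y + t) - F 0 (y + t')‖ ≤ η) (k : ℕ) (y : H) :
    ‖F k y - F 0 y‖ ≤ k * η := by
  have hT0 : (T.card : ℂ) ≠ 0 := by exact_mod_cast hT.card_pos.ne'
  -- Averaging commutes with translation, so almost periods survive every smoothing step.
  have hper : ∀ j, ∀ t ∈ T, ∀ t' ∈ T, ∀ y, ‖F j (y + t) - F j (y + t')‖ ≤ η := by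
    intro j
    induction j with
    | zero => exact hη
    | succ j ih =>
      intro t ht t' ht' y
      rw [hstep, hstep, ← sub_div]
      simp_rw [← Finset.sum_sub_distrib]
      refine norm_sum_sum_div_card_sq_le hT fun s _ s' _ => ?_
      rw [add_right_comm y t, add_right_comm y t']
      exact ih t ht t' ht' _
  have hdiff : ∀ j, ‖F (j + 1) y - F j y‖ ≤ η := by
    intro j
    have : F (j + 1) y - F j y =
        (∑ t ∈ T, ∑ t' ∈ T, (F j (y - t' + t) - F j (y - t' + t'))) / (T.card : ℂ) ^ 2 := by
      simp only [sub_add_cancel, Finset.sum_sub_distrib, Finset.sum_const, nsmul_eq_mul]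
      rw [hstep, sub_div]
      congr 1
      · congr 1
        refine Finset.sum_congr rfl fun t _ => Finset.sum_congr rfl fun t' _ => ?_
        congr 1; abel
      · field_simp
    rw [this]
    exact norm_sum_sum_div_card_sq_le hT fun t ht t' ht' => hper j t ht t' ht' _
  induction k with
  | zero => simp
  | succ k ih =>
    calc ‖F (k + 1) y - F 0 y‖ = ‖(F (k + 1) y - F k y) + (F k y - F 0 y)‖ := by
          congr 1; ring
      _ ≤ η + k * η := (norm_add_le _ _).trans (add_le_add (hdiff k) ih)
      _ = _ := by push_cast; ring

/-- The normalised energy `‖∑ t ∈ T, dualChar ℓ t‖² / |T|²` of `T` at a frequency. -/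
noncomputable def energyAt (T : Finset G) (ℓ : Module.Dual (ZMod q) G) : ℝ :=
  ‖∑ t ∈ T, dualChar ℓ t‖ ^ 2 / T.card ^ 2

/-- Averaging over T - T is a Fourier multiplier with symbol `energyAt T`; this supplies the
recursion required by `norm_iterated_average_sub_le`. -/
lemma sum_energyAt_pow_succ {T : Finset G} (hT : T.Nonempty) [Fintype (Module.Dual (ZMod q) G)]
    (c : Module.Dual (ZMod q) G → ℂ) (j : ℕ) (y : G) :
    ∑ ℓ, c ℓ * (energyAt T ℓ : ℂ) ^ (j + 1) * dualChar ℓ y =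
      (∑ t ∈ T, ∑ t' ∈ T, ∑ ℓ, c ℓ * (energyAt T ℓ : ℂ) ^ j * dualChar ℓ (y + (t - t'))) /
        (T.card : ℂ) ^ 2 := by
  have hT0 : (T.card : ℂ) ≠ 0 := by exact_mod_cast hT.card_pos.ne'
  have e : ∀ ℓ : Module.Dual (ZMod q) G,
      ∑ t ∈ T, ∑ t' ∈ T, dualChar ℓ (t - t') = (energyAt T ℓ : ℂ) * (T.card : ℂ) ^ 2 := by
    intro ℓ
    rw [sum_sum_dualChar_sub, energyAt]
    push_cast
    rw [div_mul_cancel₀ _ (pow_ne_zero 2 hT0)]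
  have h : ∑ t ∈ T, ∑ t' ∈ T, ∑ ℓ, c ℓ * (energyAt T ℓ : ℂ) ^ j * dualChar ℓ (y + (t - t')) =
      ∑ ℓ, c ℓ * (energyAt T ℓ : ℂ) ^ j * dualChar ℓ y *
        ∑ t ∈ T, ∑ t' ∈ T, dualChar ℓ (t - t') := by
    simp_rw [Finset.mul_sum, AddChar.map_add_eq_mul _ y, ← mul_assoc]
    conv_rhs => rw [Finset.sum_comm]
    refine Finset.sum_congr rfl fun t _ => ?_
    rw [Finset.sum_comm]
  rw [eq_div_iff (pow_ne_zero 2 hT0), h, Finset.sum_mul]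
  refine Finset.sum_congr rfl fun ℓ _ => ?_
  rw [e, pow_succ]
  ring

/-- Averaging over a subspace annihilated by the large spectrum of `T` barely changes a
trigonometric polynomial that has been smoothed `k` times by `T - T`. -/
lemma norm_sum_submodule_smoothed_sub_le {T : Finset G} (hT : T.Nonempty)
    (W : Submodule (ZMod q) G) [Fintype W] [Fintype (Module.Dual (ZMod q) G)]
    (hW : ∀ ℓ : Module.Dual (ZMod q) G, (T.card : ℝ) / 2 < ‖∑ t ∈ T, dualChar ℓ t‖ →
      ∀ w ∈ W, ℓ w = 0)
    (c : Module.Dual (ZMod q) G → ℂ) (k : ℕ) :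
    ‖(∑ w : W, ∑ ℓ, c ℓ * (energyAt T ℓ : ℂ) ^ k * dualChar ℓ (w : G)) / Fintype.card W -
      ∑ ℓ, c ℓ * (energyAt T ℓ : ℂ) ^ k * dualChar ℓ 0‖ ≤ 2 * ((1 / 4) ^ k * ∑ ℓ, ‖c ℓ‖) := by
  have hT0 : (0 : ℝ) < T.card := by exact_mod_cast hT.card_pos
  have hW0 : (0 : ℝ) < Fintype.card W := by exact_mod_cast Fintype.card_pos
  have hW0' : (Fintype.card W : ℂ) ≠ 0 := by exact_mod_cast hW0.ne'
  have e : (∑ w : W, ∑ ℓ, c ℓ * (energyAt T ℓ : ℂ) ^ k * dualChar ℓ (w : G)) / Fintype.card W -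
      ∑ ℓ, c ℓ * (energyAt T ℓ : ℂ) ^ k * dualChar ℓ 0 =
      ∑ ℓ, c ℓ * (energyAt T ℓ : ℂ) ^ k *
        ((∑ w : W, dualChar ℓ (w : G)) / Fintype.card W - 1) := by
    simp only [mul_sub, Finset.sum_sub_distrib, AddChar.map_zero_eq_one]
    congr 1
    rw [Finset.sum_comm, Finset.sum_div]
    refine Finset.sum_congr rfl fun ℓ _ => ?_
    rw [← Finset.mul_sum, mul_div_assoc]
  rw [e, Finset.mul_sum, Finset.mul_sum]
  refine norm_sum_le_of_le _ fun ℓ _ => ?_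
  -- On the large spectrum the character is trivial on W and the term vanishes; elsewhere the energy
  -- is at most 1/4, so k smoothings leave (1/4)^k.
  by_cases hℓ : (T.card : ℝ) / 2 < ‖∑ t ∈ T, dualChar ℓ t‖
  · have : ∑ w : W, dualChar ℓ (w : G) = Fintype.card W := by
      rw [Finset.sum_congr rfl fun (w : W) _ => by
        rw [dualChar_apply, hW ℓ hℓ w w.2, AddChar.map_zero_eq_one]]
      simp
    rw [this, div_self hW0', sub_self, mul_zero, norm_zero]
    positivity
  · rw [norm_mul, norm_mul]
    have h1 : ‖(∑ w : W, dualChar ℓ (w : G)) / (Fintype.card W : ℂ) - 1‖ ≤ 2 := by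
      refine (norm_sub_le _ _).trans ?_
      have : ‖(∑ w : W, dualChar ℓ (w : G)) / (Fintype.card W : ℂ)‖ ≤ 1 := by
        rw [norm_div, Complex.norm_natCast, div_le_one hW0]
        exact (norm_sum_le _ _).trans (by simp)
      rw [norm_one]; linarith
    have h2 : ‖(energyAt T ℓ : ℂ) ^ k‖ ≤ (1 / 4) ^ k := by
      have hρ0 : 0 ≤ energyAt T ℓ := by unfold energyAt; positivity
      rw [norm_pow, Complex.norm_real, Real.norm_of_nonneg hρ0]
      refine pow_le_pow_left₀ hρ0 ?_ k
      rw [energyAt, div_le_iff₀ (by positivity)]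
      nlinarith [norm_nonneg (∑ t ∈ T, dualChar ℓ t)]
    calc ‖c ℓ‖ * ‖(energyAt T ℓ : ℂ) ^ k‖ * _ ≤ ‖c ℓ‖ * (1 / 4) ^ k * 2 := by gcongr
      _ = _ := by ring

/-- Bootstrapping almost periodicity: a function almost invariant under `T - T` is almost invariant
under averaging over any subspace annihilated by the large spectrum of `T`. -/
lemma norm_sum_submodule_sub_le {T : Finset G} (hT : T.Nonempty) (W : Submodule (ZMod q) G)
    [Fintype W] [Fintype (Module.Dual (ZMod q) G)]
    (hW : ∀ ℓ : Module.Dual (ZMod q) G, (T.card : ℝ) / 2 < ‖∑ t ∈ T, dualChar ℓ t‖ →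
      ∀ w ∈ W, ℓ w = 0)
    {f : G → ℂ} (c : Module.Dual (ZMod q) G → ℂ) (hf : ∀ y, f y = ∑ ℓ, c ℓ * dualChar ℓ y)
    {η : ℝ} (hη : ∀ t ∈ T, ∀ t' ∈ T, ∀ y, ‖f (y + t) - f (y + t')‖ ≤ η) (k : ℕ) :
    ‖(∑ w : W, f w) / Fintype.card W - f 0‖ ≤
      2 * (k * η) + 2 * ((1 / 4) ^ k * ∑ ℓ, ‖c ℓ‖) := by
  have hW0 : (0 : ℝ) < Fintype.card W := by exact_mod_cast Fintype.card_pos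
  set F : ℕ → G → ℂ := fun j y => ∑ ℓ, c ℓ * (energyAt T ℓ : ℂ) ^ j * dualChar ℓ y with hF
  have hF0 : ∀ y, F 0 y = f y := by intro y; simp [hF, hf]
  have hk : ∀ y, ‖F k y - f y‖ ≤ k * η := by
    intro y
    rw [← hF0]
    exact norm_iterated_average_sub_le hT (sum_energyAt_pow_succ hT c)
      (by simpa only [hF0] using hη) k y
  have hsub : ‖(∑ w : W, F k w) / Fintype.card W - F k 0‖ ≤ 2 * ((1 / 4) ^ k * ∑ ℓ, ‖c ℓ‖) :=
    norm_sum_submodule_smoothed_sub_le hT W hW c k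
  have hW' : ‖(∑ w : W, F k w) / Fintype.card W - (∑ w : W, f w) / Fintype.card W‖ ≤ k * η := by
    rw [← sub_div, ← Finset.sum_sub_distrib, norm_div, Complex.norm_natCast, div_le_iff₀ hW0]
    refine (norm_sum_le_of_le univ (f := fun w : W => F k w - f w) fun w _ => hk w).trans (le_of_eq ?_)
    simp only [Finset.sum_const, Finset.card_univ, nsmul_eq_mul]
    ring
  calc ‖(∑ w : W, f w) / Fintype.card W - f 0‖
      = ‖-((∑ w : W, F k w) / Fintype.card W - (∑ w : W, f w) / Fintype.card W) +
          (F k 0 - f 0) + ((∑ w : W, F k w) / Fintype.card W - F k 0)‖ := by congr 1; ring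
    _ ≤ k * η + k * η + 2 * ((1 / 4) ^ k * ∑ ℓ, ‖c ℓ‖) := by
        refine (norm_add_le _ _).trans (add_le_add ((norm_add_le _ _).trans
          (add_le_add ?_ (hk 0))) hsub)
        rw [norm_neg]; exact hW'
    _ = _ := by ring

end Fourier

/-! ### Chang's inequality for the large spectrum. -/

section Chang

variable {q : ℕ} [Fact q.Prime] {G : Type*} [AddCommGroup G] [Module (ZMod q) G] [Fintype G]

/-- Linearly independent functionals are jointly equidistributed. -/
lemma card_mul_sum_comp_of_linearIndependent {ι : Type*} [Fintype ι] [DecidableEq ι]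
    {ℓ : ι → Module.Dual (ZMod q) G} (hℓ : LinearIndependent (ZMod q) ℓ) (Φ : (ι → ZMod q) → ℝ) :
    (q : ℝ) ^ Fintype.card ι * ∑ x, Φ (fun i => ℓ i x) = Fintype.card G * ∑ z, Φ z := by
  have hsurj : Function.Surjective (LinearMap.pi ℓ) := by
    rw [← LinearMap.range_eq_top]
    by_contra h
    -- A nonzero functional killing the range would be a linear relation between the `ℓ i`.
    obtain ⟨f, hf0, hf⟩ := Submodule.exists_le_ker_of_lt_top _ (lt_top_iff_ne_top.2 h)
    refine hf0 (LinearMap.pi_ext' fun i => LinearMap.ext_ring ?_)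
    have hz := Fintype.linearIndependent_iff.1 hℓ (fun i => f (Pi.single i 1)) (by
      ext x
      have hx : f (LinearMap.pi ℓ x) = 0 := hf (LinearMap.mem_range_self _ x)
      rw [LinearMap.pi_apply_eq_sum_univ f] at hx
      simp only [LinearMap.coe_sum, Finset.sum_apply, LinearMap.smul_apply, smul_eq_mul,
        LinearMap.zero_apply]
      rw [← hx]
      refine Finset.sum_congr rfl fun i _ => ?_
      rw [smul_eq_mul, mul_comm, LinearMap.pi_apply]
      congr 2
      ext j
      simp [Pi.single_apply, eq_comm]) i
    simpa using hz
  have key : ∀ z : ι → ZMod q, ∑ x, Φ (fun i => ℓ i x) = ∑ x, Φ ((fun i => ℓ i x) + z) := by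
    intro z
    obtain ⟨w, rfl⟩ := hsurj z
    rw [← Equiv.sum_comp (Equiv.addRight w)]
    refine Finset.sum_congr rfl fun x _ => ?_
    congr 1
    ext i
    simp
  calc (q : ℝ) ^ Fintype.card ι * ∑ x, Φ (fun i => ℓ i x)
      = ∑ _z : ι → ZMod q, ∑ x, Φ (fun i => ℓ i x) := by simp [ZMod.card]
    _ = ∑ z : ι → ZMod q, ∑ x, Φ ((fun i => ℓ i x) + z) := Finset.sum_congr rfl fun z _ => key z
    _ = ∑ x : G, ∑ z, Φ z := by
        rw [Finset.sum_comm]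
        exact Finset.sum_congr rfl fun x _ => Equiv.sum_comp (Equiv.addLeft _) Φ
    _ = _ := by simp

/-- Chang's inequality for linearly independent functionals. -/
lemma card_mul_exp_le_of_linearIndependent {ι : Type*} [Fintype ι]
    {ℓ : ι → Module.Dual (ZMod q) G} (hℓ : LinearIndependent (ZMod q) ℓ) (T : Finset G)
    (hT : ∀ i, (T.card : ℝ) / 2 ≤ ‖∑ t ∈ T, dualChar (ℓ i) t‖) :
    T.card * Real.exp (Fintype.card ι / 8) ≤ Fintype.card G := by
  classical
  have hphase : ∀ z : ℂ, ∃ c : ℂ, ‖c‖ = 1 ∧ (c * z).re = ‖z‖ := by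
    intro z
    obtain ⟨c, hc, h⟩ := RCLike.exists_norm_eq_mul_self z
    exact ⟨c, hc, by rw [← h]; simp⟩
  -- Unimodular phases make each character sum over T real and nonnegative.
  choose c hc1 hc using fun i => hphase (∑ t ∈ T, dualChar (ℓ i) t)
  set Y : ι → ZMod q → ℝ := fun i z => (c i * ZMod.stdAddChar z).re with hY
  have hYbd : ∀ i z, |Y i z| ≤ 1 := by
    intro i z
    refine (Complex.abs_re_le_norm _).trans ?_
    rw [norm_mul, hc1, AddChar.norm_apply, one_mul]
  have hY0 : ∀ i, ∑ z, Y i z = 0 := by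
    intro i
    have h1 : (ZMod.stdAddChar : AddChar (ZMod q) ℂ) ≠ 1 := by
      intro h
      have : (ZMod.stdAddChar (1 : ZMod q) : ℂ) = ZMod.stdAddChar (0 : ZMod q) := by
        rw [h]; simp
      exact one_ne_zero (ZMod.injective_stdAddChar this)
    simp only [hY]
    rw [← Complex.re_sum, ← Finset.mul_sum, AddChar.sum_eq_zero_of_ne_one h1]
    simp
  have hYT : ∀ i, (T.card : ℝ) / 2 ≤ ∑ t ∈ T, Y i (ℓ i t) := by
    intro i
    refine (hT i).trans (le_of_eq ?_)
    rw [← hc i, Finset.mul_sum, Complex.re_sum]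
    rfl
  have hq : (0 : ℝ) < q := by exact_mod_cast (Fact.out : q.Prime).pos
  have hN : (0 : ℝ) < Fintype.card G := by exact_mod_cast Fintype.card_pos
  -- Equidistribution factorises this exponential moment, and Hoeffding with parameter 1/2 bounds
  -- each factor's mean by exp(1/8).
  have hprod : ∑ x : G, Real.exp (∑ i, 1 / 2 * Y i (ℓ i x)) ≤
      Fintype.card G * Real.exp (Fintype.card ι / 8) := by
    have h1 := card_mul_sum_comp_of_linearIndependent hℓ
      (fun z => Real.exp (∑ i, 1 / 2 * Y i (z i)))
    have h2 : ∑ z : ι → ZMod q, Real.exp (∑ i, 1 / 2 * Y i (z i)) ≤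
        (q : ℝ) ^ Fintype.card ι * Real.exp (Fintype.card ι / 8) := by
      simp_rw [Real.exp_sum]
      have h := Finset.prod_univ_sum (fun _ : ι => (univ : Finset (ZMod q)))
        (fun i z => Real.exp (1 / 2 * Y i z))
      rw [Fintype.piFinset_univ] at h
      rw [← h]
      calc ∏ i, ∑ z, Real.exp (1 / 2 * Y i z)
          ≤ ∏ _i : ι, (q * Real.exp (1 / 8)) := by
            refine Finset.prod_le_prod (fun i _ => Finset.sum_nonneg fun _ _ => (Real.exp_pos _).le)
              fun i _ => ?_
            refine (sum_exp_mul_le univ (1 / 2) (fun z _ => hYbd i z) (hY0 i)).trans (le_of_eq ?_)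
            rw [Finset.card_univ, ZMod.card]
            norm_num
        _ = _ := by
            rw [Finset.prod_const, mul_pow, ← Real.exp_nat_mul, Finset.card_univ]
            congr 2; ring
    have h3 := mul_le_mul_of_nonneg_left h2 hN.le
    rw [← h1] at h3
    have hqm : (0 : ℝ) < (q : ℝ) ^ Fintype.card ι := by positivity
    refine le_of_mul_le_mul_left (h3.trans (le_of_eq ?_)) hqm
    ring
  -- On T the exponent averages at least |ι|/4, from the weight 1/2 times the spectral threshold
  -- 1/2. This beats the |ι|/8 of `hprod`.
  have hlow : (T.card : ℝ) ≤
      ∑ t ∈ T, Real.exp (∑ i, 1 / 2 * Y i (ℓ i t) - Fintype.card ι / 4) := by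
    calc (T.card : ℝ) ≤ ∑ t ∈ T, (∑ i, 1 / 2 * Y i (ℓ i t) - Fintype.card ι / 4 + 1) := by
          rw [Finset.sum_add_distrib, Finset.sum_sub_distrib, Finset.sum_comm]
          have : ∑ _i : ι, (1 / 2 * ((T.card : ℝ) / 2)) ≤ ∑ i, ∑ t ∈ T, 1 / 2 * Y i (ℓ i t) := by
            refine Finset.sum_le_sum fun i _ => ?_
            rw [← Finset.mul_sum]
            exact mul_le_mul_of_nonneg_left (hYT i) (by norm_num)
          simp only [Finset.sum_const, nsmul_eq_mul, Finset.card_univ] at this ⊢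
          linarith
      _ ≤ _ := Finset.sum_le_sum fun t _ => Real.add_one_le_exp _
  have hle : ∑ t ∈ T, Real.exp (∑ i, 1 / 2 * Y i (ℓ i t) - Fintype.card ι / 4) ≤
      Real.exp (-(Fintype.card ι / 4)) * (Fintype.card G * Real.exp (Fintype.card ι / 8)) := by
    refine le_trans ?_ (mul_le_mul_of_nonneg_left hprod (Real.exp_pos _).le)
    rw [Finset.mul_sum]
    refine le_trans (le_of_eq ?_) (Finset.sum_le_sum_of_subset_of_nonneg (Finset.subset_univ T)
      fun _ _ _ => by positivity)
    refine Finset.sum_congr rfl fun t _ => ?_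
    rw [← Real.exp_add]; congr 1; ring
  have h := mul_le_mul_of_nonneg_right (hlow.trans hle) (Real.exp_pos (Fintype.card ι / 8)).le
  refine h.trans (le_of_eq ?_)
  have e : Real.exp (-((Fintype.card ι : ℝ) / 4)) * Real.exp (Fintype.card ι / 8) *
      Real.exp (Fintype.card ι / 8) = 1 := by
    rw [← Real.exp_add, ← Real.exp_add, ← Real.exp_zero]; congr 1; ring
  linear_combination (Fintype.card G : ℝ) * e

/-- The large spectrum of a dense set is annihilated by a subspace of small codimension. -/
lemma exists_submodule_annihilating_spectrum (T : Finset G) :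
    ∃ (W : Submodule (ZMod q) G) (d : ℕ),
      Module.finrank (ZMod q) W + d = Module.finrank (ZMod q) G ∧
      T.card * Real.exp (d / 8) ≤ Fintype.card G ∧
      ∀ ℓ : Module.Dual (ZMod q) G, (T.card : ℝ) / 2 < ‖∑ t ∈ T, dualChar ℓ t‖ →
        ∀ w ∈ W, ℓ w = 0 := by
  set Δ : Set (Module.Dual (ZMod q) G) :=
    {ℓ | (T.card : ℝ) / 2 < ‖∑ t ∈ T, dualChar ℓ t‖} with hΔ
  -- Only a basis drawn from the spectrum counts towards the codimension of the annihilator.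
  obtain ⟨b, hbΔ, hspan, hli⟩ := exists_linearIndependent (ZMod q) Δ
  have : Finite (Module.Dual (ZMod q) G) := DFunLike.finite _
  let _ : Fintype b := Fintype.ofFinite b
  refine ⟨(Submodule.span (ZMod q) Δ).dualCoannihilator, Fintype.card b, ?_, ?_, ?_⟩
  · rw [← Subspace.finrank_add_finrank_dualCoannihilator_eq (Submodule.span (ZMod q) Δ), ← hspan,
      finrank_span_set_eq_card hli, Set.toFinset_card, add_comm]
  · exact card_mul_exp_le_of_linearIndependent hli T fun i => (hbΔ i.2).le
  · intro ℓ hℓ w hw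
    exact (Submodule.mem_dualCoannihilator w).1 hw ℓ (Submodule.subset_span hℓ)

end Chang

/-! ### The density increment on a subspace. -/

section Increment

variable {q : ℕ} [Fact q.Prime] {G : Type*} [AddCommGroup G] [Module (ZMod q) G] [Fintype G]

/-- The Fourier expansion of `y ↦ ∑ u ∈ B, ∑ v ∈ B, g (u - v + y) / |B|²` has small `ℓ¹` norm. -/
lemma exists_dualChar_expansion {B : Finset G} (hB : B.Nonempty) {g : G → ℝ} (hg0 : ∀ x, 0 ≤ g x)
    (hg1 : ∀ x, g x ≤ 1) [Fintype (Module.Dual (ZMod q) G)] :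
    ∃ c : Module.Dual (ZMod q) G → ℂ,
      (∀ y, (((∑ u ∈ B, ∑ v ∈ B, g (u - v + y)) / (B.card : ℝ) ^ 2 : ℝ) : ℂ) =
        ∑ ℓ, c ℓ * dualChar ℓ y) ∧
      ∑ ℓ, ‖c ℓ‖ ≤ Fintype.card G / B.card := by
  have hB0 : (0 : ℝ) < B.card := by exact_mod_cast hB.card_pos
  have hB0' : (B.card : ℂ) ≠ 0 := by exact_mod_cast hB0.ne'
  have hN : (0 : ℝ) < Fintype.card G := by exact_mod_cast Fintype.card_pos
  set a : Module.Dual (ZMod q) G → ℂ :=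
    fun ℓ => (∑ w, (g w : ℂ) * dualChar ℓ (-w)) / Fintype.card G with ha
  have ha1 : ∀ ℓ, ‖a ℓ‖ ≤ 1 := by
    intro ℓ
    rw [ha, norm_div, Complex.norm_natCast, div_le_one hN]
    refine (norm_sum_le_of_le univ (n := fun _ => (1 : ℝ)) fun w _ => ?_).trans (by simp)
    rw [norm_mul, norm_dualChar, mul_one, Complex.norm_real, Real.norm_of_nonneg (hg0 w)]
    exact hg1 w
  refine ⟨fun ℓ => a ℓ * (energyAt B ℓ : ℂ), fun y => ?_, ?_⟩
  · push_cast
    rw [div_eq_iff (pow_ne_zero 2 hB0'), Finset.sum_mul]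
    have h1 : ∀ u v : G, (g (u - v + y) : ℂ) = ∑ ℓ, a ℓ * dualChar ℓ y * dualChar ℓ (u - v) := by
      intro u v
      rw [eq_sum_dualChar (q := q) (fun x => (g x : ℂ)) (u - v + y)]
      refine Finset.sum_congr rfl fun ℓ _ => ?_
      rw [AddChar.map_add_eq_mul]
      simp only [ha]; ring
    have h2 : ∀ ℓ : Module.Dual (ZMod q) G,
        ∑ u ∈ B, ∑ v ∈ B, dualChar ℓ (u - v) = (energyAt B ℓ : ℂ) * (B.card : ℂ) ^ 2 := by
      intro ℓ
      rw [sum_sum_dualChar_sub, energyAt]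
      push_cast
      rw [div_mul_cancel₀ _ (pow_ne_zero 2 hB0')]
    calc ∑ u ∈ B, ∑ v ∈ B, (g (u - v + y) : ℂ)
        = ∑ ℓ, a ℓ * dualChar ℓ y * ∑ u ∈ B, ∑ v ∈ B, dualChar ℓ (u - v) := by
          simp_rw [h1, Finset.mul_sum]
          conv_rhs => rw [Finset.sum_comm]
          refine Finset.sum_congr rfl fun u _ => ?_
          rw [Finset.sum_comm]
      _ = _ := by
          refine Finset.sum_congr rfl fun ℓ _ => ?_
          rw [h2]; ring
  · calc ∑ ℓ, ‖a ℓ * (energyAt B ℓ : ℂ)‖ ≤ ∑ ℓ : Module.Dual (ZMod q) G, energyAt B ℓ := by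
          refine Finset.sum_le_sum fun ℓ _ => ?_
          have hρ0 : 0 ≤ energyAt B ℓ := by unfold energyAt; positivity
          rw [norm_mul, Complex.norm_real, Real.norm_of_nonneg hρ0]
          exact mul_le_of_le_one_left hρ0 (ha1 ℓ)
      _ = _ := by
          unfold energyAt
          rw [← Finset.sum_div, sum_norm_sq_sum_dualChar]
          field_simp

/-- If most differences of a dense set `B` lie in `{g = 1}`, then a translate of a subspace of
small codimension lies mostly in `{g = 1}`. -/
lemma exists_submodule_sum_ge {B : Finset G} (hB : B.Nonempty) {g : G → ℝ} (hg0 : ∀ x, 0 ≤ g x)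
    (hg1 : ∀ x, g x ≤ 1) (hg : 19 / 20 * (B.card : ℝ) ^ 2 ≤ ∑ u ∈ B, ∑ v ∈ B, g (u - v))
    {k : ℕ} (hk : k ≠ 0) (hkB : 1000 * (Fintype.card G : ℝ) ≤ Real.exp k * B.card) :
    ∃ (W : Submodule (ZMod q) G) (_ : Fintype W) (d : ℕ) (z : G),
      Module.finrank (ZMod q) W + d = Module.finrank (ZMod q) G ∧
      d ≤ 2000000 * k ^ 4 ∧ 9 / 10 * (Fintype.card W : ℝ) ≤ ∑ w : W, g (z + w) := by
  classical
  have hk0 : (0 : ℝ) < k := by exact_mod_cast Nat.pos_of_ne_zero hk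
  have hk1 : (1 : ℝ) ≤ k := by exact_mod_cast Nat.one_le_iff_ne_zero.2 hk
  have hB0 : (0 : ℝ) < B.card := by exact_mod_cast hB.card_pos
  have hN : (0 : ℝ) < Fintype.card G := by exact_mod_cast Fintype.card_pos
  have : Finite (Module.Dual (ZMod q) G) := DFunLike.finite _
  let _ : Fintype (Module.Dual (ZMod q) G) := Fintype.ofFinite _
  obtain ⟨T, hTcard, hT⟩ := exists_almost_periods hB hg0 hg1 hk hkB
  have hT0 : (0 : ℝ) < T.card := by
    by_contra h
    have h0 : (T.card : ℝ) = 0 := le_antisymm (not_lt.1 h) (by positivity)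
    rw [h0] at hTcard
    have : 0 < (B.card : ℝ) ^ (204800 * k ^ 3) * Fintype.card G := by positivity
    linarith
  have hTne : T.Nonempty := Finset.card_pos.1 (by exact_mod_cast hT0)
  obtain ⟨W, d, hWd, hd, hW⟩ := exists_submodule_annihilating_spectrum (q := q) T
  let instW : Fintype W := Fintype.ofFinite W
  obtain ⟨c, hc, hcsum⟩ := exists_dualChar_expansion (q := q) hB hg0 hg1
  set F : G → ℝ := fun y => (∑ u ∈ B, ∑ v ∈ B, g (u - v + y)) / (B.card : ℝ) ^ 2 with hF
  have hW0 : (0 : ℝ) < Fintype.card W := by exact_mod_cast Fintype.card_pos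
  have hcl := norm_sum_submodule_sub_le hTne W hW (f := fun y => (F y : ℂ)) c hc
    (η := 1 / (160 * k)) (fun t ht t' ht' y => by
      rw [← Complex.ofReal_sub, Complex.norm_real]
      exact hT t ht t' ht' y) k
  have hFW : 9 / 10 * (Fintype.card W : ℝ) ≤ ∑ w : W, F w := by
    have e : (∑ w : W, (F w : ℂ)) / Fintype.card W - (F 0 : ℂ) =
        (((∑ w : W, F w) / Fintype.card W - F 0 : ℝ) : ℂ) := by push_cast; rfl
    rw [e, Complex.norm_real, Real.norm_eq_abs] at hcl
    have h1 := (abs_le.1 hcl).1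
    have hF0 : 19 / 20 ≤ F 0 := by
      simp only [hF, add_zero]
      rw [le_div_iff₀ (by positivity)]
      exact hg
    have h2 : (k : ℝ) * (1 / (160 * k)) = 1 / 160 := by field_simp
    -- The ℓ¹ norm is at most |G|/|B| ≤ exp(k)/1000, and e < 4.
    have h3 : (1 / 4 : ℝ) ^ k * ∑ ℓ, ‖c ℓ‖ ≤ 1 / 1000 := by
      have h4 : (Fintype.card G : ℝ) / B.card ≤ Real.exp k / 1000 := by
        rw [div_le_div_iff₀ hB0 (by norm_num)]; linarith
      have h5 : (1 / 4 : ℝ) ^ k * Real.exp k ≤ 1 := by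
        rw [← Real.exp_one_pow, ← mul_pow]
        exact pow_le_one₀ (by positivity) (by linarith [Real.exp_one_lt_d9])
      calc (1 / 4 : ℝ) ^ k * ∑ ℓ, ‖c ℓ‖ ≤ (1 / 4 : ℝ) ^ k * (Real.exp k / 1000) := by
            gcongr; exact hcsum.trans h4
        _ ≤ _ := by linarith
    rw [h2] at h1
    have h6 : 9 / 10 ≤ (∑ w : W, F w) / Fintype.card W := by linarith
    rwa [le_div_iff₀ hW0] at h6
  have hsum : ∑ u ∈ B, ∑ v ∈ B, 9 / 10 * (Fintype.card W : ℝ) ≤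
      ∑ u ∈ B, ∑ v ∈ B, ∑ w : W, g (u - v + w) := by
    have e : ∑ u ∈ B, ∑ v ∈ B, ∑ w : W, g (u - v + w) = (∑ w : W, F w) * (B.card : ℝ) ^ 2 := by
      simp only [hF]
      rw [← Finset.sum_div, div_mul_cancel₀ _ (by positivity)]
      conv_rhs => rw [Finset.sum_comm]
      refine Finset.sum_congr rfl fun u _ => ?_
      rw [Finset.sum_comm]
    rw [e]
    simp only [Finset.sum_const, nsmul_eq_mul]
    nlinarith [mul_le_mul_of_nonneg_right hFW (sq_nonneg (B.card : ℝ))]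
  obtain ⟨u, -, hu⟩ := Finset.exists_le_of_sum_le hB hsum
  obtain ⟨v, -, hv⟩ := Finset.exists_le_of_sum_le hB hu
  refine ⟨W, instW, d, u - v, hWd, ?_, hv⟩
  -- T has density at least exp(-kn)/2, so Chang gives d ≤ 8(1 + kn), which is at most 2000000 k⁴.
  set n := 204800 * k ^ 3 with hn
  have h1 : (Fintype.card G : ℝ) ^ n ≤ Real.exp (k * n) * (B.card : ℝ) ^ n := by
    rw [mul_comm (k : ℝ), Real.exp_nat_mul, ← mul_pow]
    exact pow_le_pow_left₀ hN.le (by linarith) n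
  have h2 : Real.exp (d / 8) ≤ 2 * Real.exp (k * n) := by
    have hpos : 0 < (B.card : ℝ) ^ n * T.card := by positivity
    refine le_of_mul_le_mul_left ?_ hpos
    calc (B.card : ℝ) ^ n * T.card * Real.exp (d / 8)
        = (B.card : ℝ) ^ n * (T.card * Real.exp (d / 8)) := by ring
      _ ≤ (B.card : ℝ) ^ n * Fintype.card G := by gcongr
      _ ≤ 2 * (T.card * (Fintype.card G : ℝ) ^ n) := hTcard
      _ ≤ 2 * (T.card * (Real.exp (k * n) * (B.card : ℝ) ^ n)) := by gcongr
      _ = _ := by ring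
  have h3 : Real.exp (d / 8) ≤ Real.exp (1 + k * n) := by
    rw [Real.exp_add]
    refine h2.trans (mul_le_mul_of_nonneg_right ?_ (Real.exp_pos _).le)
    linarith [Real.exp_one_gt_d9]
  have h4 := Real.exp_le_exp.1 h3
  have h5 : (d : ℝ) ≤ 2000000 * (k : ℝ) ^ 4 := by
    rw [hn] at h4
    push_cast at h4
    have : (1 : ℝ) ≤ (k : ℝ) ^ 4 := one_le_pow₀ hk1
    nlinarith
  exact_mod_cast h5

/-- The density increment for sets with few three-term progressions. -/
lemma exists_density_increment (h2 : Function.Injective fun x : G => x + x) [DecidableEq G]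
    {A : Finset G} (hA : A.Nonempty)
    (hT : ((threeAPs A).card : ℝ) ≤ (A.card : ℝ) ^ 3 / Fintype.card G / 2) {p k : ℕ}
    (hp : Even p) (hpA : 40 ≤ (6 / 5 : ℝ) ^ p * (A.card / Fintype.card G)) (hk : k ≠ 0)
    (hkA : 2000000 ≤ Real.exp k ^ 2 * ((A.card : ℝ) / Fintype.card G) ^ (2 * p + 1)) :
    ∃ (W : Submodule (ZMod q) G) (_ : Fintype W) (d : ℕ) (x : G),
      Module.finrank (ZMod q) W + d = Module.finrank (ZMod q) G ∧
      d ≤ 2000000 * k ^ 4 ∧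
      9 / 8 * ((A.card : ℝ) / Fintype.card G) * Fintype.card W ≤ ∑ w : W, ind A (x + w) := by
  have hN : (0 : ℝ) < Fintype.card G := by exact_mod_cast Fintype.card_pos
  have hA0 : (0 : ℝ) < A.card := by exact_mod_cast hA.card_pos
  set N : ℝ := (Fintype.card G : ℝ) with hNdef
  set m : ℝ := (A.card : ℝ) ^ 2 / N with hm
  have hm0 : 0 < m := by positivity
  have hr : ∀ x, 0 ≤ autocorr (ind A) x := fun x =>
    Finset.sum_nonneg fun y _ => mul_nonneg (ind_nonneg _ _) (ind_nonneg _ _)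
  have hM := le_sum_autocorr_pow_of_card_threeAPs_le h2 hA hT hp
  rw [← hNdef, ← hm] at hM
  -- Points below 5m/4 contribute at most |G|(5m/4)^p; the ratio 6/5 = (3/2)/(5/4) raised to the
  -- power p makes this negligible.
  obtain ⟨B, hB1, hB2⟩ := exists_sift A p (5 / 4 * m) (by
    refine le_trans ?_ hM
    have h1 : ∑ x, (if autocorr (ind A) x < 5 / 4 * m then (1 : ℝ) else 0) *
        autocorr (ind A) x ^ p ≤ N * (5 / 4 * m) ^ p := by
      calc _ ≤ ∑ _x : G, (5 / 4 * m) ^ p := by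
            refine Finset.sum_le_sum fun x _ => ?_
            split_ifs with h
            · rw [one_mul]; exact pow_le_pow_left₀ (hr x) h.le p
            · rw [zero_mul]; positivity
        _ = _ := by simp [hNdef]
    have h3 : 40 * N ≤ (6 / 5 : ℝ) ^ p * A.card := by
      rw [mul_div_assoc', le_div_iff₀ hN] at hpA
      exact hpA
    have h4 : (3 / 2 * m) ^ p = (6 / 5) ^ p * (5 / 4 * m) ^ p := by
      rw [← mul_pow]; congr 1; ring
    calc _ ≤ 40 * (N * (5 / 4 * m) ^ p) := by gcongr
      _ = 40 * N * (5 / 4 * m) ^ p := by ring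
      _ ≤ (6 / 5 : ℝ) ^ p * A.card * (5 / 4 * m) ^ p := by gcongr
      _ = _ := by rw [h4]; ring)
  rw [← hNdef] at hB1
  have hBsq : ((A.card : ℝ) / N) ^ (2 * p + 1) * N ^ 2 ≤ 2 * (B.card : ℝ) ^ 2 := by
    have hpos : 0 < N ^ p := by positivity
    refine le_of_mul_le_mul_right ?_ hpos
    calc ((A.card : ℝ) / N) ^ (2 * p + 1) * N ^ 2 * N ^ p = A.card * m ^ p * N := by
          rw [hm, pow_succ, pow_mul, div_pow (A.card : ℝ) N 2, div_pow, div_pow, ← pow_mul,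
            ← pow_mul]
          field_simp
          ring
      _ ≤ A.card * (3 / 2 * m) ^ p * N := by gcongr; linarith
      _ ≤ _ := by
          refine (mul_le_mul_of_nonneg_right hM hN.le).trans (hB1.trans (le_of_eq ?_))
          ring
  have hkB : 1000 * N ≤ Real.exp k * B.card := by
    refine le_of_sq_le_sq ?_ (by positivity)
    have h3 := mul_le_mul_of_nonneg_right hkA (sq_nonneg N)
    have h4 := mul_le_mul_of_nonneg_left hBsq (sq_nonneg (Real.exp k))
    rw [mul_pow, mul_pow]
    linarith
  have hB : B.Nonempty := by
    rw [Finset.nonempty_iff_ne_empty]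
    rintro rfl
    simp at hkB
    linarith
  obtain ⟨W, instW, d, z, hWd, hd, hz⟩ := exists_submodule_sum_ge (q := q) hB
    (g := fun x => 1 - if autocorr (ind A) x < 5 / 4 * m then (1 : ℝ) else 0)
    (fun x => by split_ifs <;> norm_num) (fun x => by split_ifs <;> norm_num)
    (by
      simp only [Finset.sum_sub_distrib, Finset.sum_const, nsmul_eq_mul]
      linarith) hk hkB
  -- The autocorrelation summed over z + W counts A on the translates z + y + W with y in A. It is
  -- at least 5m/4 on 9/10 of z + W, and 5/4 · 9/10 = 9/8.
  have hsum : ∑ y ∈ A, 9 / 8 * ((A.card : ℝ) / N) * Fintype.card W ≤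
      ∑ y ∈ A, ∑ w : W, ind A (z + y + w) := by
    have e : ∑ y ∈ A, ∑ w : W, ind A (z + y + w) = ∑ w : W, autocorr (ind A) (z + w) := by
      rw [Finset.sum_comm]
      refine Finset.sum_congr rfl fun w _ => ?_
      unfold autocorr
      conv_rhs =>
        enter [2, y]
        rw [show ind A y = if y ∈ A then (1 : ℝ) else 0 from rfl, mul_ite, mul_one, mul_zero]
      rw [← Finset.sum_filter, Finset.filter_mem_eq_inter, Finset.univ_inter]
      refine Finset.sum_congr rfl fun y _ => ?_
      rw [add_right_comm]
    rw [e]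
    calc ∑ y ∈ A, 9 / 8 * ((A.card : ℝ) / N) * Fintype.card W
        = 5 / 4 * m * (9 / 10 * Fintype.card W) := by
          simp only [Finset.sum_const, nsmul_eq_mul, hm]; ring
      _ ≤ 5 / 4 * m * ∑ w : W, (1 - if autocorr (ind A) (z + w) < 5 / 4 * m then (1 : ℝ) else 0) := by
          gcongr
      _ ≤ _ := by
          rw [Finset.mul_sum]
          refine Finset.sum_le_sum fun w _ => ?_
          split_ifs with h
          · simpa using hr _
          · simpa using not_lt.1 h
  obtain ⟨y, -, hy⟩ := Finset.exists_le_of_sum_le hA hsum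
  exact ⟨W, instW, d, z + y, hWd, hd, hy⟩

end Increment

/-! ### Choice of parameters and iteration. -/

section Iteration

lemma add_self_injective {q : ℕ} [Fact q.Prime] (hq : Odd q) {G : Type*} [AddCommGroup G]
    [Module (ZMod q) G] : Function.Injective fun x : G => x + x := by
  have h2 : (2 : ZMod q) ≠ 0 := by
    intro h
    have hdvd : q ∣ 2 := (ZMod.natCast_eq_zero_iff 2 q).1 (by exact_mod_cast h)
    have hq2 : q = 2 := le_antisymm (Nat.le_of_dvd two_pos hdvd) (Fact.out : q.Prime).two_le
    rw [hq2] at hq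
    exact absurd hq (by decide)
  intro x y h
  simp only [← two_smul (ZMod q)] at h
  exact smul_right_injective G h2 h

lemma log_two_div_ge {α : ℝ} (h0 : 0 < α) (h1 : α ≤ 1) : 69 / 100 ≤ Real.log (2 / α) := by
  have : Real.log 2 ≤ Real.log (2 / α) :=
    Real.log_le_log (by norm_num) (by rw [le_div_iff₀ h0]; linarith)
  linarith [Real.log_two_gt_d9]

lemma eq_two_mul_exp_neg_log {α : ℝ} (h0 : 0 < α) : α = 2 * Real.exp (-Real.log (2 / α)) := by
  rw [Real.exp_neg, Real.exp_log (by positivity)]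
  field_simp

/-- Parameters for the density increment at density `α`, in terms of `log (2 / α)`. -/
lemma exists_increment_parameters {α : ℝ} (h0 : 0 < α) (h1 : α ≤ 1) :
    ∃ p k : ℕ, Even p ∧ 40 ≤ (6 / 5 : ℝ) ^ p * α ∧ k ≠ 0 ∧
      2000000 ≤ Real.exp k ^ 2 * α ^ (2 * p + 1) ∧ (k : ℝ) ≤ 80 * Real.log (2 / α) ^ 2 := by
  set L := Real.log (2 / α) with hL
  have hL0 : 69 / 100 ≤ L := log_two_div_ge h0 h1
  have hα : α = 2 * Real.exp (-L) := eq_two_mul_exp_neg_log h0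
  set a := ⌈L + 3⌉₊ with ha
  have ha1 : L + 3 ≤ a := Nat.le_ceil _
  have ha2 : (a : ℝ) ≤ L + 4 := by
    have := Nat.ceil_lt_add_one (show 0 ≤ L + 3 by linarith); linarith
  set k := ⌈56 * L ^ 2 + L + 8⌉₊ with hk
  have hk1 : 56 * L ^ 2 + L + 8 ≤ k := Nat.le_ceil _
  have hk2 : (k : ℝ) ≤ 56 * L ^ 2 + L + 9 := by
    have := Nat.ceil_lt_add_one (show 0 ≤ 56 * L ^ 2 + L + 8 by positivity); linarith
  -- Since (6/5)⁸ > e, p = 8a gives (6/5)^p α ≥ 2e³ ≥ 40. The choice of k ensures 2k ≥ 15 + (2p +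
  -- 1)L; using 2/α keeps L ≥ 0.69, so lower-order terms fit inside 80L².
  refine ⟨8 * a, k, ⟨4 * a, by ring⟩, ?_, ?_, ?_, ?_⟩
  · have e1 : Real.exp a ≤ (6 / 5 : ℝ) ^ (8 * a) := by
      rw [pow_mul, ← Real.exp_one_pow]
      exact pow_le_pow_left₀ (Real.exp_pos _).le (by norm_num; linarith [Real.exp_one_lt_d9]) a
    have e2 : Real.exp (L + 3) ≤ Real.exp a := Real.exp_le_exp.2 ha1
    have e3 : (20 : ℝ) ≤ Real.exp 3 := by
      have : Real.exp 3 = Real.exp 1 ^ 3 := by rw [Real.exp_one_pow]; norm_num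
      rw [this]
      exact le_trans (by norm_num)
        (pow_le_pow_left₀ (by norm_num) Real.exp_one_gt_d9.le 3)
    have e4 : Real.exp (L + 3) * α = 2 * Real.exp 3 := by
      rw [hα, Real.exp_add, Real.exp_neg]; field_simp
    calc (40 : ℝ) ≤ Real.exp (L + 3) * α := by rw [e4]; linarith
      _ ≤ _ := mul_le_mul_of_nonneg_right (e2.trans e1) h0.le
  · intro h
    rw [h] at hk1
    push_cast at hk1
    nlinarith
  · have e1 : Real.exp (-L) ^ (2 * (8 * a) + 1) ≤ α ^ (2 * (8 * a) + 1) :=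
      pow_le_pow_left₀ (Real.exp_pos _).le (by rw [hα]; linarith [Real.exp_pos (-L)]) _
    have e2 : (2000000 : ℝ) ≤ Real.exp 15 := by
      have : Real.exp 15 = Real.exp 1 ^ 15 := by rw [Real.exp_one_pow]; norm_num
      rw [this]
      exact le_trans (by norm_num)
        (pow_le_pow_left₀ (by norm_num) Real.exp_one_gt_d9.le 15)
    refine e2.trans (le_trans ?_ (mul_le_mul_of_nonneg_left e1 (by positivity)))
    rw [← Real.exp_nat_mul, ← Real.exp_nat_mul, ← Real.exp_add, Real.exp_le_exp]
    push_cast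
    nlinarith
  · nlinarith

lemma card_threeAPs_preimage_le {q : ℕ} {G : Type*} [AddCommGroup G] [Module (ZMod q) G]
    [Fintype G] [DecidableEq G] (A : Finset G) (W : Submodule (ZMod q) G) [Fintype W]
    [DecidableEq W] (x : G) :
    (threeAPs (univ.filter fun w : W => x + (w : G) ∈ A)).card ≤ (threeAPs A).card := by
  refine Finset.card_le_card_of_injOn (fun p => (x + (p.1 : G), (p.2 : G))) ?_ ?_
  · intro p hp
    simpa [threeAPs, add_assoc] using hp
  · rintro ⟨a, b⟩ - ⟨c, d⟩ - h
    simpa using h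

universe u

/-- Iterating the density increment at most `j` times. -/
lemma card_threeAPs_ge_of_iterate {q : ℕ} [Fact q.Prime] (hq : Odd q) (j : ℕ) :
    ∀ (G : Type u) [AddCommGroup G] [Module (ZMod q) G] [Fintype G] [DecidableEq G]
      (A : Finset G) (D : ℕ), A.Nonempty →
      2000000 * 80 ^ 4 * Real.log (2 / ((A.card : ℝ) / Fintype.card G)) ^ 8 ≤ D →
      (Fintype.card G : ℝ) < (9 / 8) ^ j * A.card →
      (A.card : ℝ) ^ 3 / Fintype.card G / 2 ≤ (q : ℝ) ^ (2 * j * D) * (threeAPs A).card := by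
  have hq1 : (1 : ℝ) ≤ q := by exact_mod_cast (Fact.out : q.Prime).one_lt.le
  have hq0 : (0 : ℝ) < q := by linarith
  induction j with
  | zero =>
    intro G _ _ _ _ A D _ _ h
    have : (A.card : ℝ) ≤ Fintype.card G := by exact_mod_cast Finset.card_le_univ A
    simp only [pow_zero, one_mul] at h
    -- With no increments left the size hypothesis would force |A| > |G|.
    linarith
  | succ j ih =>
    intro G _ _ _ _ A D hA hD hj
    have hN : (0 : ℝ) < Fintype.card G := by exact_mod_cast Fintype.card_pos
    have hA0 : (0 : ℝ) < A.card := by exact_mod_cast hA.card_pos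
    rcases lt_or_ge ((A.card : ℝ) ^ 3 / Fintype.card G / 2) ((threeAPs A).card : ℝ) with hT | hT
    · exact hT.le.trans (le_mul_of_one_le_left (by positivity) (one_le_pow₀ hq1))
    set α : ℝ := (A.card : ℝ) / Fintype.card G with hα
    have hα0 : 0 < α := by positivity
    have hα1 : α ≤ 1 := by
      rw [hα, div_le_one hN]; exact_mod_cast Finset.card_le_univ A
    obtain ⟨p, k, hp, hpA, hk, hkA, hkL⟩ := exists_increment_parameters hα0 hα1
    obtain ⟨W, instW, d, x, hWd, hd, hinc⟩ :=
      exists_density_increment (q := q) (add_self_injective hq) hA hT hp hpA hk hkA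
    classical
    rw [← hα] at hinc
    set A' : Finset W := univ.filter fun w : W => x + (w : G) ∈ A with hA'
    have hcard : ∑ w : W, ind A (x + w) = A'.card := by
      rw [hA', Finset.card_filter]; push_cast; rfl
    rw [hcard] at hinc
    have hW0 : (0 : ℝ) < Fintype.card W := by exact_mod_cast Fintype.card_pos
    have hA'0 : (0 : ℝ) < A'.card := lt_of_lt_of_le (by positivity) hinc
    have hdD : d ≤ D := by
      have h1 : (d : ℝ) ≤ D := by
        refine le_trans ?_ hD
        have h2 : (d : ℝ) ≤ 2000000 * (k : ℝ) ^ 4 := by exact_mod_cast hd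
        have h3 := pow_le_pow_left₀ (Nat.cast_nonneg k) hkL 4
        rw [mul_pow, ← pow_mul] at h3
        linarith
      exact_mod_cast h1
    have hα' : α ≤ (A'.card : ℝ) / Fintype.card W := by
      rw [le_div_iff₀ hW0]
      have : 0 ≤ α * Fintype.card W := by positivity
      linarith
    have hα'1 : (A'.card : ℝ) / Fintype.card W ≤ 1 := by
      rw [div_le_one hW0]; exact_mod_cast Finset.card_le_univ A'
    -- The logarithm decreases as the density grows, so one bound D on the codimension serves at
    -- every step.
    have hIH := ih W A' D (Finset.card_pos.1 (by exact_mod_cast hA'0)) (by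
      refine le_trans ?_ hD
      have h1 := log_two_div_ge (hα0.trans_le hα') hα'1
      have h2 : Real.log (2 / ((A'.card : ℝ) / Fintype.card W)) ≤ Real.log (2 / α) :=
        Real.log_le_log (div_pos two_pos (hα0.trans_le hα')) (by gcongr)
      have := pow_le_pow_left₀ (by linarith) h2 8
      linarith) (by
      have h1 : 1 < (9 / 8) ^ (j + 1) * α := by
        rw [hα, mul_div_assoc', lt_div_iff₀ hN]; linarith
      have h2 : (9 / 8 : ℝ) ^ j * (9 / 8 * α * Fintype.card W) ≤ (9 / 8) ^ j * A'.card := by gcongr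
      have h3 := mul_lt_mul_of_pos_right h1 hW0
      rw [pow_succ] at h3
      linarith)
    have hcount : ((threeAPs A').card : ℝ) ≤ (threeAPs A).card := by
      exact_mod_cast card_threeAPs_preimage_le A W x
    have hNW : (Fintype.card G : ℝ) = Fintype.card W * (q : ℝ) ^ d := by
      have h1 := Module.card_eq_pow_finrank (K := ZMod q) (V := G)
      have h2 := Module.card_eq_pow_finrank (K := ZMod q) (V := W)
      rw [ZMod.card] at h1 h2
      rw [h1, h2, ← hWd]
      push_cast
      rw [pow_add]
    have hqd : (q : ℝ) ^ (2 * d) ≤ (q : ℝ) ^ (2 * D) := pow_le_pow_right₀ hq1 (by omega)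
    have hcube : α ^ 3 * (Fintype.card W : ℝ) ^ 2 ≤ (A'.card : ℝ) ^ 3 / Fintype.card W := by
      rw [le_div_iff₀ hW0]
      rw [le_div_iff₀ hW0] at hα'
      have := pow_le_pow_left₀ (by positivity) hα' 3
      rw [mul_pow] at this
      linarith
    calc (A.card : ℝ) ^ 3 / Fintype.card G / 2
        = (q : ℝ) ^ (2 * d) * (α ^ 3 * (Fintype.card W : ℝ) ^ 2 / 2) := by
          have : (A.card : ℝ) ^ 3 / Fintype.card G = α ^ 3 * (Fintype.card G : ℝ) ^ 2 := by
            rw [hα]; field_simp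
          rw [this, hNW]; ring
      _ ≤ (q : ℝ) ^ (2 * D) * ((A'.card : ℝ) ^ 3 / Fintype.card W / 2) := by gcongr
      _ ≤ (q : ℝ) ^ (2 * D) * ((q : ℝ) ^ (2 * j * D) * (threeAPs A').card) := by gcongr
      _ ≤ (q : ℝ) ^ (2 * D) * ((q : ℝ) ^ (2 * j * D) * (threeAPs A).card) := by gcongr
      _ = _ := by rw [← mul_assoc, ← pow_add]; congr 2; ring

end Iteration

/-! ### The counting theorem and the density bound. -/

section Main

lemma exp_one_le_of_odd_prime {q : ℕ} [Fact q.Prime] (hq : Odd q) : Real.exp 1 ≤ q := by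
  have h2 := (Fact.out : q.Prime).two_le
  have h3 : 3 ≤ q := by
    rcases hq with ⟨m, rfl⟩
    omega
  have : (3 : ℝ) ≤ q := by exact_mod_cast h3
  linarith [Real.exp_one_lt_d9]

/-- The absolute constant in the exponent of the counting theorem. -/
noncomputable def codimConst : ℝ := 100 * (2000000 * 80 ^ 4)

lemma card_threeAPs_ge {q : ℕ} [Fact q.Prime] (hq : Odd q) {n : ℕ} {A : Finset (Fin n → ZMod q)}
    {α : ℝ} (h0 : 0 < α) (hα : (A.card : ℝ) = α * (q : ℝ) ^ n) :
    1 / 2 * (q : ℝ) ^ (2 * (n : ℝ) - codimConst * Real.log (2 / α) ^ 9) ≤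
      ((threeAPs A).card : ℝ) := by
  have hqe := exp_one_le_of_odd_prime hq
  have hq1 : (1 : ℝ) ≤ q := by linarith [Real.exp_one_gt_d9]
  have hq0 : (0 : ℝ) < q := by linarith
  have hN : (Fintype.card (Fin n → ZMod q) : ℝ) = (q : ℝ) ^ n := by simp [ZMod.card]
  have hqn : (0 : ℝ) < (q : ℝ) ^ n := by positivity
  have hα' : (A.card : ℝ) / Fintype.card (Fin n → ZMod q) = α := by
    rw [hN, hα, mul_div_cancel_right₀ _ hqn.ne']
  have h1 : α ≤ 1 := by
    rw [← hα', div_le_one (by rw [hN]; exact hqn)]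
    exact_mod_cast Finset.card_le_univ A
  have hA : A.Nonempty := by
    refine Finset.card_pos.1 ?_
    have : (0 : ℝ) < A.card := by rw [hα]; positivity
    exact_mod_cast this
  set L := Real.log (2 / α) with hL
  have hL0 : 69 / 100 ≤ L := log_two_div_ge h0 h1
  have hLexp : α = 2 * Real.exp (-L) := eq_two_mul_exp_neg_log h0
  set K : ℝ := 2000000 * 80 ^ 4 with hK
  set D := ⌈K * L ^ 8⌉₊ with hD
  have hD1 : K * L ^ 8 ≤ D := Nat.le_ceil _
  have hD2 : (D : ℝ) ≤ K * L ^ 8 + 1 := (Nat.ceil_lt_add_one (by positivity)).le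
  set a := ⌈L⌉₊ with ha
  have ha1 : L ≤ a := Nat.le_ceil _
  have ha2 : (a : ℝ) ≤ L + 1 := (Nat.ceil_lt_add_one (by linarith)).le
  -- Because (9/8)⁹ > e, 9a increments would raise the density from α to at least 2.
  have hj : (Fintype.card (Fin n → ZMod q) : ℝ) < (9 / 8) ^ (9 * a) * A.card := by
    have e1 : Real.exp a ≤ (9 / 8 : ℝ) ^ (9 * a) := by
      rw [pow_mul, ← Real.exp_one_pow]
      exact pow_le_pow_left₀ (Real.exp_pos _).le (by norm_num; linarith [Real.exp_one_lt_d9]) a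
    have e2 : Real.exp L ≤ (9 / 8 : ℝ) ^ (9 * a) := (Real.exp_le_exp.2 ha1).trans e1
    have e3 : Real.exp L * α = 2 := by rw [hLexp, Real.exp_neg]; field_simp
    have e4 := mul_le_mul_of_nonneg_right e2 h0.le
    rw [e3] at e4
    rw [hN, hα]
    nlinarith
  have hmain := card_threeAPs_ge_of_iterate hq (9 * a) (Fin n → ZMod q) A D hA
    (by rw [hα']; exact hD1) hj
  have hcube : (A.card : ℝ) ^ 3 / Fintype.card (Fin n → ZMod q) / 2 =
      α ^ 3 * (q : ℝ) ^ (2 * n) / 2 := by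
    rw [hN, hα, pow_mul, pow_right_comm]
    field_simp
  rw [hcube] at hmain
  have hαq : (q : ℝ) ^ (-(3 * L)) ≤ α ^ 3 := by
    have e1 : (q : ℝ) ^ (-(3 * L)) ≤ Real.exp 1 ^ (-(3 * L)) :=
      Real.rpow_le_rpow_of_nonpos (Real.exp_pos _) hqe (by linarith)
    have e2 : Real.exp 1 ^ (-(3 * L)) = Real.exp (-L) ^ 3 := by
      rw [Real.exp_one_rpow, ← Real.exp_nat_mul]; congr 1; push_cast; ring
    rw [e2] at e1
    exact e1.trans (pow_le_pow_left₀ (Real.exp_pos _).le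
      (by rw [hLexp]; linarith [Real.exp_pos (-L)]) 3)
  -- The iteration costs at most 18 · (5/2) · 2 = 90 times K L⁹, and the factor α³ ≥ q^(-3L) at most
  -- 10 K L⁹ more; hence 100 in `codimConst`.
  have hexp : 2 * (n : ℝ) - codimConst * L ^ 9 ≤
      -(3 * L) + 2 * n - (2 * (9 * a) * D : ℕ) := by
    have hL8 : 1 / 20 ≤ L ^ 8 :=
      le_trans (by norm_num) (pow_le_pow_left₀ (by norm_num) hL0 8)
    have e1 : (D : ℝ) ≤ 2 * K * L ^ 8 := by
      have : (1 : ℝ) ≤ K * L ^ 8 := by rw [hK]; linarith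
      linarith
    have e2 : (a : ℝ) ≤ 5 / 2 * L := by linarith
    have e3 : (a : ℝ) * D ≤ 5 / 2 * L * (2 * K * L ^ 8) := by gcongr
    have e4 : L ≤ 20 * (L * L ^ 8) := by nlinarith
    have e5 : L ^ 9 = L * L ^ 8 := by ring
    have e6 : 0 ≤ L * L ^ 8 := by positivity
    push_cast
    rw [codimConst, ← hK, e5]
    have hK60 : (60 : ℝ) ≤ 10 * K := by rw [hK]; norm_num
    nlinarith
  have hpow : (q : ℝ) ^ (2 * (n : ℝ) - codimConst * L ^ 9) * (q : ℝ) ^ (2 * (9 * a) * D) ≤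
      α ^ 3 * (q : ℝ) ^ (2 * n) := by
    calc (q : ℝ) ^ (2 * (n : ℝ) - codimConst * L ^ 9) * (q : ℝ) ^ (2 * (9 * a) * D)
        ≤ (q : ℝ) ^ (-(3 * L) + 2 * n - (2 * (9 * a) * D : ℕ)) * (q : ℝ) ^ (2 * (9 * a) * D) := by
          gcongr
      _ = (q : ℝ) ^ (-(3 * L)) * (q : ℝ) ^ (2 * n) := by
          rw [Real.rpow_sub hq0, Real.rpow_natCast, div_mul_cancel₀ _ (by positivity),
            Real.rpow_add hq0]
          congr 1
          rw [← Real.rpow_natCast]; push_cast; rfl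
      _ ≤ _ := by gcongr
  have hfin := hpow.trans (show α ^ 3 * (q : ℝ) ^ (2 * n) ≤
    2 * (threeAPs A).card * (q : ℝ) ^ (2 * (9 * a) * D) by linarith)
  have := le_of_mul_le_mul_right hfin (by positivity)
  linarith

lemma density_le_of_threeAPs_trivial {q : ℕ} [Fact q.Prime] (hq : Odd q) {n : ℕ}
    {A : Finset (Fin n → ZMod q)} {α : ℝ} (hα : (A.card : ℝ) = α * (q : ℝ) ^ n)
    (hA : ∀ x d : Fin n → ZMod q, x ∈ A → x + d ∈ A → x + 2 • d ∈ A → d = 0) :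
    α ≤ 2 * (q : ℝ) ^ (-((1 / (2 * codimConst) / Real.log q) * (n : ℝ) ^ ((1 : ℝ) / 9))) := by
  have hqe := exp_one_le_of_odd_prime hq
  have hq1 : (1 : ℝ) < q := by linarith [Real.exp_one_gt_d9]
  have hq0 : (0 : ℝ) < q := by linarith
  have hqn : (0 : ℝ) < (q : ℝ) ^ n := by positivity
  -- The empty set is allowed here and needs no count.
  rcases le_or_gt α 0 with h0 | h0
  · exact h0.trans (by positivity)
  have h1 : α ≤ 1 := by
    have : (A.card : ℝ) ≤ (q : ℝ) ^ n := by
      have h : (A.card : ℝ) ≤ Fintype.card (Fin n → ZMod q) := by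
        exact_mod_cast Finset.card_le_univ A
      simpa [ZMod.card] using h
    rw [hα] at this
    exact le_of_mul_le_mul_right (by linarith) hqn
  have hcount := card_threeAPs_ge hq h0 hα
  set L := Real.log (2 / α) with hL
  have hL0 : 69 / 100 ≤ L := log_two_div_ge h0 h1
  have htriv : ((threeAPs A).card : ℝ) ≤ (q : ℝ) ^ n := by
    have h : (threeAPs A).card ≤ A.card := by
      refine Finset.card_le_card_of_injOn Prod.fst ?_ ?_
      · intro p hp
        exact (Finset.mem_filter.1 hp).2.1
      · rintro ⟨x, d⟩ hx ⟨x', d'⟩ hx' h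
        obtain ⟨-, a1, a2, a3⟩ := Finset.mem_filter.1 hx
        obtain ⟨-, b1, b2, b3⟩ := Finset.mem_filter.1 hx'
        rw [Prod.mk.injEq]
        exact ⟨h, (hA x d a1 a2 a3).trans (hA x' d' b1 b2 b3).symm⟩
    have h' : ((threeAPs A).card : ℝ) ≤ A.card := by exact_mod_cast h
    rw [hα] at h'
    exact h'.trans (mul_le_of_le_one_left hqn.le h1)
  -- Only trivial progressions remain, at most q^n of them; the +1 absorbs the constant 1/2, as q ≥
  -- 2.
  have hn : (n : ℝ) ≤ codimConst * L ^ 9 + 1 := by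
    have e1 : (q : ℝ) ^ (2 * (n : ℝ) - codimConst * L ^ 9) ≤ (q : ℝ) ^ ((n : ℝ) + 1) := by
      rw [Real.rpow_add_one hq0.ne', Real.rpow_natCast]
      have : (2 : ℝ) ≤ q := by linarith [Real.exp_one_gt_d9]
      nlinarith
    have := (Real.rpow_le_rpow_left_iff hq1).1 e1
    linarith
  have hC1 : (100 : ℝ) ≤ codimConst := by rw [codimConst]; norm_num
  have hn' : (n : ℝ) ≤ (2 * codimConst * L) ^ 9 := by
    have hL9 : 1 / 100 ≤ L ^ 9 :=
      le_trans (by norm_num) (pow_le_pow_left₀ (by norm_num) hL0 9)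
    have hC9 : 2 * codimConst ≤ (2 * codimConst) ^ 9 :=
      le_self_pow₀ (by linarith) (by norm_num)
    rw [mul_pow]
    have := mul_le_mul_of_nonneg_right hC9 (by positivity : 0 ≤ L ^ 9)
    nlinarith
  have hroot : (n : ℝ) ^ ((1 : ℝ) / 9) ≤ 2 * codimConst * L := by
    have h : (n : ℝ) ^ ((1 : ℝ) / 9) ≤ ((2 * codimConst * L) ^ 9) ^ ((1 : ℝ) / 9) :=
      Real.rpow_le_rpow (by positivity) hn' (by norm_num)
    refine h.trans (le_of_eq ?_)
    have hpos : 0 ≤ 2 * codimConst * L := by positivity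
    rw [one_div]
    exact_mod_cast Real.pow_rpow_inv_natCast hpos (by norm_num : (9 : ℕ) ≠ 0)
  have hlogq : 0 < Real.log q := Real.log_pos hq1
  -- The division by log q cancels the base, leaving a bound independent of q to compare with α = 2
  -- exp(-L).
  have hfin : (q : ℝ) ^ (-((1 / (2 * codimConst) / Real.log q) * (n : ℝ) ^ ((1 : ℝ) / 9))) =
      Real.exp (-((n : ℝ) ^ ((1 : ℝ) / 9) / (2 * codimConst))) := by
    rw [Real.rpow_def_of_pos hq0]
    congr 1
    field_simp
  rw [hfin]
  conv_lhs => rw [eq_two_mul_exp_neg_log h0]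
  have : (n : ℝ) ^ ((1 : ℝ) / 9) / (2 * codimConst) ≤ L := by
    rw [div_le_iff₀ (by linarith)]; linarith
  exact mul_le_mul_of_nonneg_left (Real.exp_le_exp.2 (neg_le_neg this)) (by norm_num)

theorem theorem2 :
    (∃ c C : ℝ, 0 < c ∧ 0 < C ∧
      ∀ (q : ℕ) [Fact q.Prime], Odd q →
        ∀ (n : ℕ) (A : Finset (Fin n → ZMod q)) (α : ℝ),
          0 < α → (A.card : ℝ) = α * (q : ℝ) ^ n →
            c * (q : ℝ) ^ (2 * (n : ℝ) - C * Real.log (2 / α) ^ 9) ≤ ((threeAPs A).card : ℝ)) ∧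
    (∃ c C : ℝ, 0 < c ∧ 0 < C ∧
      ∀ (q : ℕ) [Fact q.Prime], Odd q →
        ∀ (n : ℕ) (A : Finset (Fin n → ZMod q)) (α : ℝ),
          (A.card : ℝ) = α * (q : ℝ) ^ n →
            (∀ x d : Fin n → ZMod q, x ∈ A → x + d ∈ A → x + 2 • d ∈ A → d = 0) →
              α ≤ C * (q : ℝ) ^ (-((c / Real.log q) * (n : ℝ) ^ ((1 : ℝ) / 9)))) := by
  have hC : 0 < codimConst := by rw [codimConst]; norm_num
  refine ⟨⟨1 / 2, codimConst, by norm_num, hC, fun q _ hq n A α h0 hα => ?_⟩,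
    ⟨1 / (2 * codimConst), 2, by positivity, by norm_num, fun q _ hq n A α hα hA => ?_⟩⟩
  · exact card_threeAPs_ge hq h0 hα
  · exact density_le_of_threeAPs_trivial hq hα hA

end Main
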